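/- Let $n\ge 0$ be an integer, let $\mathbb{C}(q)$ be the field of rational functions in $q$, and let $E_{ij}$ be the $n\times n$ matrix units. Put $$R=q\sum_i E_{ii}\otimes E_{ii}+\sum_{i\neq j}E_{ii}\otimes E_{jj}+(q-q^{-1})\sum_{i>j}E_{ji}\otimes E_{ij},\qquad \Omega=\sum_{i,j}E_{ij}\otimes E_{ji},$$ and let $R_{21}$ be $R$ with its two tensor factors exchanged. Let $\mathcal{D}_1$ be the $\mathbb{C}(q)$-algebra with generators $x_{ij},\partial_{ij}$ ($1\le i,j\le n$), collected in the matrices $X=\sum_{i,j}E_{ij}\otimes x_{ij}$ and $D=\sum_{i,j}E_{ij}\otimes\partial_{ij}$, and with relations $$R_{21}X_1RX_2=X_2R_{21}X_1R,\qquad R^{-1}D_1R_{21}^{-1}D_2=D_2R^{-1}D_1R_{21}^{-1},$$ $$D_1R_{21}^{-1}X_2R_{21}=RX_2R_{21}D_1+(q-q^{-1})R\Omega,$$ where a subscript $1$ or $2$ on $X$ or $D$ tells in which tensor factor the matrix units are placed. Let $\mathcal{D}_1^{\mathbb{Z}}\subset\mathcal{D}_1$ be the $\mathbb{C}[q^{\pm1}]$-subalgebra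 generated by all $x_{ij}$ and $\partial_{ij}$. A standard monomial is a product $$\partial_{k_1l_1}\cdots\partial_{k_Nl_N}\,x_{i_1j_1}\cdots x_{i_Mj_M}\qquad (M,N\ge 0)$$ in which $(i_1,j_1),\ldots,(i_M,j_M)$ is weakly increasing and $(k_1,l_1),\ldots,(k_N,l_N)$ is weakly decreasing in the lexicographic order. **Proposition.** The standard monomials (indexed by the pairs of sequences as above) form a basis of $\mathcal{D}_1^{\mathbb{Z}}$ as a $\mathbb{C}[q^{\pm1}]$-module. Consequently $\mathcal{D}_1$ is a flat deformation of the coordinate ring of $T^*(\mathrm{Mat}_{n\times n})$, in the following sense: $\mathcal{D}_1^{\mathbb{Z}}$ is flat over $\mathbb{C}[q^{\pm1}]$; the inclusion $\mathcal{D}_1^{\mathbb{Z}}\subset\mathcal{D}_1$ induces an isomorphism $\mathbb{C}(q)\otimes_{\mathbb{C}[q^{\pm1}]}\mathcal{D}_1^{\mathbb{Z}}\cong\mathcal{D}_1$; and there is an isomorphism of $\mathbb{C}$-algebras from $\mathcal{D}_1^{\mathbb{Z}}/(q-1)\mathcal{D}_1^{\mathbb{Z}}$ onto the coordinate ring of $T^*(\mathrm{Mat}_{n\times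 n})\cong\mathrm{Mat}_{n\times n}\times\mathrm{Mat}_{n\times n}$ (trace pairing), the polynomial ring in $2n^2$ variables, that sends the classes of the $x_{ij}$ and of the $\partial_{ij}$ to the entries of the first and of the second matrix, respectively. -/

import Mathlib

open scoped LaurentPolynomial Kronecker

noncomputable section

namespace QDiff

/-- The ring `ℂ[q, q⁻¹]` of Laurent polynomials. -/
abbrev A : Type := ℂ[T;T⁻¹]

/-- The field `ℂ(q)`, as the fraction field of `ℂ[q, q⁻¹]`. -/
abbrev K : Type := FractionRing A

/-- The parameter `q` in `ℂ[q, q⁻¹]`. -/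
def qA : A := LaurentPolynomial.T 1

/-- The parameter `q` in `ℂ(q)`. -/
def q : K := algebraMap A K qA

/-- The `R`-matrix
`q ∑ᵢ Eᵢᵢ ⊗ Eᵢᵢ + ∑_{i ≠ j} Eᵢᵢ ⊗ Eⱼⱼ + (q - q⁻¹) ∑_{i > j} Eⱼᵢ ⊗ Eᵢⱼ`. -/
def R (n : ℕ) : Matrix (Fin n × Fin n) (Fin n × Fin n) K :=
  q • ∑ i : Fin n, Matrix.single i i (1 : K) ⊗ₖ Matrix.single i i (1 : K)
    + ∑ i : Fin n, ∑ j ∈ Finset.univ.filter (fun j : Fin n => i ≠ j),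
        Matrix.single i i (1 : K) ⊗ₖ Matrix.single j j (1 : K)
    + (q - q⁻¹) • ∑ i : Fin n, ∑ j ∈ Finset.univ.filter (fun j : Fin n => j < i),
        Matrix.single j i (1 : K) ⊗ₖ Matrix.single i j (1 : K)

/-- `M₂₁`: the two tensor factors are exchanged. -/
def flip21 {n : ℕ} (M : Matrix (Fin n × Fin n) (Fin n × Fin n) K) :
    Matrix (Fin n × Fin n) (Fin n × Fin n) K :=
  M.submatrix Prod.swap Prod.swap

/-- `Ω = ∑ᵢⱼ Eᵢⱼ ⊗ Eⱼᵢ`. -/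
def Omega (n : ℕ) : Matrix (Fin n × Fin n) (Fin n × Fin n) K :=
  ∑ i : Fin n, ∑ j : Fin n, Matrix.single i j (1 : K) ⊗ₖ Matrix.single j i (1 : K)

/-- The generators: `Gen.x i j` stands for `xᵢⱼ` and `Gen.d i j` for `∂ᵢⱼ`. -/
inductive Gen (n : ℕ) : Type
  | x (i j : Fin n) : Gen n
  | d (i j : Fin n) : Gen n

/-- The free `ℂ(q)`-algebra on the generators. -/
abbrev Free (n : ℕ) : Type := FreeAlgebra K (Gen n)

/-- A scalar matrix, viewed over the free algebra. -/
def scal {n : ℕ} (M : Matrix (Fin n × Fin n) (Fin n × Fin n) K) :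
    Matrix (Fin n × Fin n) (Fin n × Fin n) (Free n) :=
  M.map (algebraMap K (Free n))

/-- The generating matrix `𝐗 = ∑ᵢⱼ Eᵢⱼ ⊗ xᵢⱼ`. -/
def X (n : ℕ) : Matrix (Fin n) (Fin n) (Free n) :=
  Matrix.of fun i j => FreeAlgebra.ι K (Gen.x i j)

/-- The generating matrix `𝐃 = ∑ᵢⱼ Eᵢⱼ ⊗ ∂ᵢⱼ`. -/
def D (n : ℕ) : Matrix (Fin n) (Fin n) (Free n) :=
  Matrix.of fun i j => FreeAlgebra.ι K (Gen.d i j)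

/-- `M₁`: the matrix units are placed in the first tensor factor. -/
def inFst {n : ℕ} (M : Matrix (Fin n) (Fin n) (Free n)) :
    Matrix (Fin n × Fin n) (Fin n × Fin n) (Free n) :=
  M ⊗ₖ (1 : Matrix (Fin n) (Fin n) (Free n))

/-- `M₂`: the matrix units are placed in the second tensor factor. -/
def inSnd {n : ℕ} (M : Matrix (Fin n) (Fin n) (Free n)) :
    Matrix (Fin n × Fin n) (Fin n × Fin n) (Free n) :=
  (1 : Matrix (Fin n) (Fin n) (Free n)) ⊗ₖ M

/-- The defining relations of `𝓓₁`, entry by entry: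
* `R₂₁ X₁ R X₂ = X₂ R₂₁ X₁ R`;
* `R⁻¹ D₁ R₂₁⁻¹ D₂ = D₂ R⁻¹ D₁ R₂₁⁻¹`;
* `D₁ R₂₁⁻¹ X₂ R₂₁ = R X₂ R₂₁ D₁ + (q - q⁻¹) R Ω`. -/
inductive Rel (n : ℕ) : Free n → Free n → Prop
  | xx (a b : Fin n × Fin n) : Rel n
      ((scal (flip21 (R n)) * inFst (X n) * scal (R n) * inSnd (X n)) a b)
      ((inSnd (X n) * scal (flip21 (R n)) * inFst (X n) * scal (R n)) a b)
  | dd (a b : Fin n × Fin n) : Rel n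
      ((scal (R n)⁻¹ * inFst (D n) * scal (flip21 (R n))⁻¹ * inSnd (D n)) a b)
      ((inSnd (D n) * scal (R n)⁻¹ * inFst (D n) * scal (flip21 (R n))⁻¹) a b)
  | dx (a b : Fin n × Fin n) : Rel n
      ((inFst (D n) * scal (flip21 (R n))⁻¹ * inSnd (X n) * scal (flip21 (R n))) a b)
      ((scal (R n) * inSnd (X n) * scal (flip21 (R n)) * inFst (D n)
        + scal ((q - q⁻¹) • (R n * Omega n))) a b)

/-- The `ℂ(q)`-algebra `𝓓₁`. -/
def D1 (n : ℕ) : Type := RingQuot (Rel n)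

instance (n : ℕ) : Ring (D1 n) :=
  (Algebra.semiringToRing K : Ring (RingQuot (Rel n)))

instance (n : ℕ) : Algebra K (D1 n) := inferInstanceAs (Algebra K (RingQuot (Rel n)))

instance (n : ℕ) : Algebra A (D1 n) := inferInstanceAs (Algebra A (RingQuot (Rel n)))

instance (n : ℕ) : Algebra ℂ (D1 n) := inferInstanceAs (Algebra ℂ (RingQuot (Rel n)))

instance (n : ℕ) : IsScalarTower A K (D1 n) :=
  inferInstanceAs (IsScalarTower A K (RingQuot (Rel n)))

instance (n : ℕ) : IsScalarTower ℂ A (D1 n) :=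
  inferInstanceAs (IsScalarTower ℂ A (RingQuot (Rel n)))

/-- The quotient map from the free algebra. -/
def toD1 (n : ℕ) : Free n →ₐ[K] D1 n := RingQuot.mkAlgHom K (Rel n)

/-- The element `xᵢⱼ` of `𝓓₁`. -/
def x {n : ℕ} (i j : Fin n) : D1 n := toD1 n (FreeAlgebra.ι K (Gen.x i j))

/-- The element `∂ᵢⱼ` of `𝓓₁`. -/
def d {n : ℕ} (i j : Fin n) : D1 n := toD1 n (FreeAlgebra.ι K (Gen.d i j))

/-- The integral form: the `ℂ[q, q⁻¹]`-subalgebra of `𝓓₁` generated by all `xᵢⱼ`, `∂ᵢⱼ`. -/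
def D1Z (n : ℕ) : Subalgebra A (D1 n) :=
  Algebra.adjoin A ({y | ∃ i j : Fin n, y = x i j} ∪ {y | ∃ i j : Fin n, y = d i j})

/-- The element `xᵢⱼ` of the integral form. -/
def xZ {n : ℕ} (i j : Fin n) : D1Z n :=
  ⟨x i j, Algebra.subset_adjoin (Or.inl ⟨i, j, rfl⟩)⟩

/-- The element `∂ᵢⱼ` of the integral form. -/
def dZ {n : ℕ} (i j : Fin n) : D1Z n :=
  ⟨d i j, Algebra.subset_adjoin (Or.inr ⟨i, j, rfl⟩)⟩

/-- Index set of the standard monomials: a sequence of pairs that is (weakly) decreasing for the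
lexicographic order (the indices of the `∂`s) and a sequence of pairs that is (weakly) increasing
for it (the indices of the `x`s). -/
structure StdIndex (n : ℕ) : Type where
  ds : List (Fin n ×ₗ Fin n)
  xs : List (Fin n ×ₗ Fin n)
  ds_decreasing : ds.Pairwise (fun a b => b ≤ a)
  xs_increasing : xs.Pairwise (fun a b => a ≤ b)

/-- The standard monomial `∂_{k₁l₁} ⋯ ∂_{k_N l_N} x_{i₁j₁} ⋯ x_{i_M j_M}`. -/
def stdMonomial {n : ℕ} (s : StdIndex n) : D1 n :=
  (s.ds.map fun p => d (ofLex p).1 (ofLex p).2).prod *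
    (s.xs.map fun p => x (ofLex p).1 (ofLex p).2).prod

/-- The ideal `(q - 1) 𝓓₁^ℤ`. -/
def qOneIdeal (n : ℕ) : Ideal (D1Z n) :=
  Ideal.span {algebraMap A (D1Z n) (qA - 1)}

/-- The generator is central, so the left ideal it generates is two-sided. -/
instance (n : ℕ) : (qOneIdeal n).IsTwoSided := by
  refine ⟨fun {a} b ha => ?_⟩
  obtain ⟨c, rfl⟩ := Ideal.mem_span_singleton'.mp ha
  refine Ideal.mem_span_singleton'.mpr ⟨c * b, ?_⟩
  rw [mul_assoc, mul_assoc, Algebra.commutes]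

/-- The fibre `𝓓₁^ℤ / (q - 1) 𝓓₁^ℤ` of the integral form at `q = 1`. -/
abbrev D1AtOne (n : ℕ) : Type := D1Z n ⧸ qOneIdeal n

/-- The coordinate ring of `T^*(Mat_{n×n}) = Mat_{n×n} × (Mat_{n×n})^*`, with `(Mat_{n×n})^*`
identified with `Mat_{n×n}` by the trace pairing: the polynomial ring on the `n²` entries of the
first matrix (`Gen.x i j`) and the `n²` entries of the second one (`Gen.d i j`). -/
abbrev CoordRing (n : ℕ) : Type := MvPolynomial (Gen n) ℂ

end QDiff

end

/-! Let `P` be the flip `Ω` and `b = P R`, a Hecke braiding. Since `X₁ = P X₂ P`, all relations can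
be written with the generators in the last factor only: `b X b X = X b X b`, the same for `D` with
`b⁻¹`, and `X b D = b⁻¹ D b⁻¹ X b - (q - q⁻¹)` (`braidedRel_iff`).

Spanning. Entry by entry these relations are triangular for the order on indices, with leading
coefficients powers of `q`. So they hold over `ℂ[q, q⁻¹]`, they move every `x` to the right of every
`∂` (`mul_mem_of_exchange`), and they rewrite a misordered pair of letters of one kind with a
smaller first letter (`reflection_straighten`).

Independence. Let `∂` act on the free algebra in the letters `∂` by left multiplication. The
exchange relation together with `N 1 = 0` determines annihilation operators `N` recursively
(`exists_annihilation`), and `x` acts by `-(q - q⁻¹) N`. The braid and Hecke relations show that the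
`N` satisfy their reflection equation on the whole free algebra (`reflection_annihilation`) and
preserve the ideal of the reflection relations among the `∂` (`annihilation_mem_reflectionIdeal`).
Hence the quotient by that ideal is a representation of `𝓓₁`. Because the factor `q - q⁻¹` has been
taken out, `N b c` specializes at `q = 1` to the partial derivative with respect to the variable
`(c, b)` (`Spec.annihilation`). A linear relation between standard monomials therefore specializes
to one between the operators "monomial times iterated derivative", whose coefficients must vanish
(`FockRelation.evOne_eq_zero`). So all coefficients are divisible by `q - 1`; dividing and
repeating, they are divisible by every power of `q - 1` and are zero.

The rest follows from the basis. Freeness gives flatness, and clearing denominators gives the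
generic fibre. At `q = 1` the relations become commutativity, so the polynomial ring surjects onto
the fibre; reading coordinates in the basis at `q = 1` shows injectivity (`exists_equiv_atOne`). -/

open scoped LaurentPolynomial Kronecker

noncomputable section

namespace QDiff

/-! ### Matrices in tensor factors and the Hecke braiding. -/

section Braiding

variable {ι k B : Type*} [Fintype ι] [DecidableEq ι] [CommRing k] [Ring B] [Algebra k B]

/-- The braiding attached to the Hecke `R`-matrix of a strict order `r` with parameter `q`. -/
def brd (r : ι → ι → Prop) [DecidableRel r] (q qi : k) : Matrix (ι × ι) (ι × ι) k :=
  Matrix.of fun u v => (if v = u.swap then (if u.1 = u.2 then q else 1) else 0)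
    + (if v = u then (if r u.2 u.1 then q - qi else 0) else 0)

/-- A matrix acting in the last tensor factor. -/
def inLast (o : Type*) [Fintype o] [DecidableEq o] {m : Type*} [Fintype m] [DecidableEq m] :
    Matrix m m B →+* Matrix (o × m) (o × m) B where
  toFun M := Matrix.of fun u v => if u.1 = v.1 then M u.2 v.2 else 0
  map_one' := by
    ext ⟨a, i⟩ ⟨b, j⟩
    by_cases h : a = b <;> by_cases h' : i = j <;> simp [Matrix.one_apply, h, h']
  map_zero' := by ext; simp
  map_add' M N := by ext u v; by_cases h : u.1 = v.1 <;> simp [h]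
  map_mul' M N := by
    ext ⟨a, i⟩ ⟨b, j⟩
    simp [Matrix.mul_apply, Fintype.sum_prod_type]

theorem inLast_apply {o : Type*} [Fintype o] [DecidableEq o] {m : Type*} [Fintype m]
    [DecidableEq m] (M : Matrix m m B) (a b : o) (i j : m) :
    inLast o M (a, i) (b, j) = if a = b then M i j else 0 := rfl

theorem inLast_mul_apply {o : Type*} [Fintype o] [DecidableEq o] {m z : Type*} [Fintype m]
    [DecidableEq m] (M : Matrix m m B) (N : Matrix (o × m) z B) (a : o) (i : m) (j : z) :
    (inLast o M * N) (a, i) j = ∑ e, M i e * N (a, e) j := by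
  simp [Matrix.mul_apply, Fintype.sum_prod_type, inLast_apply]

/-- The entries of a scalar matrix, viewed in an algebra. -/
abbrev scalars (B : Type*) [Ring B] [Algebra k B] (m : Type*) [Fintype m] [DecidableEq m] :
    Matrix m m k →+* Matrix m m B := (algebraMap k B).mapMatrix

/-- The braiding in the first two of three tensor factors. -/
def brdFst (r : ι → ι → Prop) [DecidableRel r] (q qi : k) :
    Matrix (ι × ι × ι) (ι × ι × ι) k :=
  Matrix.of fun u v => if u.2.2 = v.2.2 then brd r q qi (u.1, u.2.1) (v.1, v.2.1) else 0

variable (r : ι → ι → Prop) [DecidableRel r] (q qi : k)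

theorem brd_mul_apply {z : Type*} (M : Matrix (ι × ι) z B) (a b : ι) (j : z) :
    (scalars B _ (brd r q qi) * M) (a, b) j
      = (if a = b then q else 1) • M (b, a) j + (if r b a then q - qi else 0) • M (a, b) j := by
  simp [Matrix.mul_apply, brd, add_mul, Finset.sum_add_distrib, ite_mul, Algebra.smul_def,
    apply_ite (algebraMap k B)]

theorem mul_brd_apply {z : Type*} (M : Matrix z (ι × ι) B) (c d : ι) (j : z) :
    (M * scalars B _ (brd r q qi)) j (c, d)
      = (if c = d then q else 1) • M j (d, c) + (if r d c then q - qi else 0) • M j (c, d) := by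
  have h : ∀ v : ι × ι, ((c, d) = v.swap) ↔ v = (d, c) := by
    rintro ⟨x, y⟩
    simp only [Prod.swap_prod_mk, Prod.mk.injEq]
    constructor <;> rintro ⟨rfl, rfl⟩ <;> simp
  simp only [Matrix.mul_apply, brd, RingHom.mapMatrix_apply, Matrix.map_apply, Matrix.of_apply,
    map_add, apply_ite (algebraMap k B), map_zero, mul_add, Finset.sum_add_distrib, mul_ite,
    mul_zero, h, Finset.sum_ite_eq', Finset.mem_univ, if_true,
    eq_comm (a := (c, d))]
  congr 1
  · by_cases h1 : c = d
    · subst h1; simp [Algebra.smul_def, Algebra.commutes]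
    · simp [h1, Ne.symm h1]
  · by_cases h1 : r d c
    · simp only [h1, if_true, Algebra.smul_def, Algebra.commutes]
    · simp [h1]

theorem brdFst_mul_apply {z : Type*} (M : Matrix (ι × ι × ι) z B) (a b c : ι) (j : z) :
    (scalars B _ (brdFst r q qi) * M) (a, b, c) j
      = (if a = b then q else 1) • M (b, a, c) j
        + (if r b a then q - qi else 0) • M (a, b, c) j := by
  refine Eq.trans ?_ (brd_mul_apply r q qi (Matrix.of fun (u : ι × ι) j => M (u.1, u.2, c) j) a b j)
  simp [Matrix.mul_apply, brdFst, Fintype.sum_prod_type, ite_mul, apply_ite (algebraMap k B)]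

theorem brdFst_comm_inLast (M : Matrix ι ι B) :
    scalars B _ (brdFst r q qi) * inLast ι (inLast ι M)
      = inLast ι (inLast ι M) * scalars B _ (brdFst r q qi) := by
  ext ⟨a, b, c⟩ ⟨a', b', c'⟩
  simp [Matrix.mul_apply, brdFst, Fintype.sum_prod_type, inLast_apply, Algebra.commutes, ite_mul,
    mul_ite, apply_ite (algebraMap k B)]

theorem scalars_inLast (M : Matrix (ι × ι) (ι × ι) k) :
    scalars B _ (inLast ι M) = inLast ι (scalars B _ M) := by
  ext ⟨a, b⟩ ⟨a', b'⟩
  simp [inLast_apply, apply_ite (algebraMap k B)]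

/-- Source of all the triangularity arguments: one leading product with a unit coefficient (when `q`
is invertible), and a correction that occurs only for `a = c` and whose summation index precedes
`a`. -/
theorem sandwich_apply (M N : Matrix ι ι B) (a b c d : ι) :
    (inLast ι M * scalars B _ (brd r q qi) * inLast ι N) (a, b) (c, d)
      = (if a = c then q else 1) • (M b c * N a d)
        + (if a = c then q - qi else 0) • ∑ e with r e a, M b e * N e d := by
  rw [mul_assoc, inLast_mul_apply]
  simp only [brd_mul_apply, inLast_apply, mul_add, Finset.sum_add_distrib]
  congr 1
  · simp
  · by_cases h : a = c
    · simp [h, Finset.sum_filter, Finset.smul_sum]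
    · simp [h]

end Braiding

/-! ### Inverse, quadratic and braid relations for the braiding. -/

section Relations

variable {ι k : Type*} [Fintype ι] [LinearOrder ι] [CommRing k] {q qi : k}

/-- Testing on column vectors turns products of braidings into iterated two-term formulas, leaving
only a case check on the order of the indices. -/
theorem matrix_ext_mul {m : Type*} [Fintype m] [DecidableEq m] {M N : Matrix m m k}
    (h : ∀ v : Matrix m Unit k, scalars k m M * v = scalars k m N * v) : M = N := by
  ext i j
  have := congrFun (congrFun (h (Matrix.of fun x _ => if x = j then 1 else 0)) i) ()
  simpa [Matrix.mul_apply] using this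

theorem brd_mul_brd_inv (h : q * qi = 1) :
    brd (ι := ι) (· < ·) q qi * brd (· > ·) qi q = 1 := by
  refine matrix_ext_mul fun v => ?_
  ext ⟨a, b⟩ z
  rw [map_mul, Matrix.mul_assoc, brd_mul_apply, brd_mul_apply, brd_mul_apply, map_one,
    Matrix.one_mul]
  simp only [smul_eq_mul]
  rcases lt_trichotomy a b with h1 | h1 | h1
  · simp [h1, h1.ne, h1.ne', h1.not_gt]
  · subst h1; simp; linear_combination (v (a, a) z) * h
  · simp [h1, h1.ne, h1.ne', h1.not_gt]; ring

theorem brd_inv_mul_brd (h : q * qi = 1) :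
    brd (ι := ι) (· > ·) qi q * brd (· < ·) q qi = 1 := by
  refine matrix_ext_mul fun v => ?_
  ext ⟨a, b⟩ z
  rw [map_mul, Matrix.mul_assoc, brd_mul_apply, brd_mul_apply, brd_mul_apply, map_one,
    Matrix.one_mul]
  simp only [smul_eq_mul]
  rcases lt_trichotomy a b with h1 | h1 | h1
  · simp [h1, h1.ne, h1.ne', h1.not_gt]; ring
  · subst h1; simp; linear_combination (v (a, a) z) * h
  · simp [h1, h1.ne, h1.ne', h1.not_gt]

theorem brd_inv_eq : brd (ι := ι) (· > ·) qi q = brd (· < ·) q qi - (q - qi) • 1 := by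
  refine matrix_ext_mul fun v => ?_
  ext ⟨a, b⟩ z
  have : scalars k (ι × ι) ((q - qi) • (1 : Matrix (ι × ι) (ι × ι) k)) * v = (q - qi) • v := by
    ext i j; simp [Matrix.mul_apply, Matrix.one_apply]
  rw [map_sub, Matrix.sub_mul, this, Matrix.sub_apply, brd_mul_apply, brd_mul_apply]
  simp only [smul_eq_mul, Matrix.smul_apply]
  rcases lt_trichotomy a b with h1 | h1 | h1
  · simp [h1, h1.ne, h1.not_gt]; ring
  · subst h1; simp; ring
  · simp [h1, h1.ne', h1.not_gt]

theorem brdFst_mul_inv (h : q * qi = 1) :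
    brdFst (ι := ι) (· < ·) q qi * brdFst (· > ·) qi q = 1 := by
  refine matrix_ext_mul fun v => ?_
  ext ⟨a, b, c⟩ z
  rw [map_mul, Matrix.mul_assoc, brdFst_mul_apply, brdFst_mul_apply, brdFst_mul_apply, map_one,
    Matrix.one_mul]
  simp only [smul_eq_mul]
  rcases lt_trichotomy a b with h1 | h1 | h1
  · simp [h1, h1.ne, h1.ne', h1.not_gt]
  · subst h1; simp; linear_combination (v (a, a, c) z) * h
  · simp [h1, h1.ne, h1.ne', h1.not_gt]; ring

theorem brdFst_inv_eq : brdFst (ι := ι) (· > ·) qi q = brdFst (· < ·) q qi - (q - qi) • 1 := by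
  ext ⟨a, b, c⟩ ⟨a', b', c'⟩
  have := congrFun (congrFun (brd_inv_eq (ι := ι) (q := q) (qi := qi)) (a, b)) (a', b')
  by_cases h : c = c'
  · subst h
    simpa [brdFst, Matrix.one_apply] using this
  · simp [brdFst, h]

theorem braid_relation (h : q * qi = 1) :
    brdFst (ι := ι) (· < ·) q qi * inLast ι (brd (· < ·) q qi) * brdFst (· < ·) q qi
      = inLast ι (brd (· < ·) q qi) * brdFst (· < ·) q qi * inLast ι (brd (· < ·) q qi) := by
  have key : ∀ (v : Matrix (ι × ι × ι) Unit k) (a b c : ι) (z : Unit),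
      (scalars k (ι × ι × ι) (inLast ι (brd (· < ·) q qi)) * v) (a, b, c) z
      = (if b = c then q else 1) • v (a, c, b) z
        + (if c < b then q - qi else 0) • v (a, b, c) z := by
    intro v a b c z
    rw [scalars_inLast, inLast_mul_apply]
    exact brd_mul_apply (B := k) _ q qi (Matrix.of fun u j => v (a, u) j) b c z
  refine matrix_ext_mul fun v => ?_
  ext ⟨a, b, c⟩ z
  simp only [map_mul, Matrix.mul_assoc]
  simp only [brdFst_mul_apply, key, smul_eq_mul]
  rcases lt_trichotomy a b with h1 | h1 | h1 <;> rcases lt_trichotomy b c with h2 | h2 | h2 <;>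
    rcases lt_trichotomy a c with h3 | h3 | h3 <;>
    first
    | (exfalso; order)
    | (try subst h1
       try subst h2
       try subst h3
       simp [*, ne_of_lt, ne_of_gt, not_lt_of_gt]
       try first
         | ring1
         | linear_combination (q - qi) * v (a, a, c) z * h
         | linear_combination (qi - q) * v (a, b, b) z * h)

end Relations

/-! ### Reflection equations in a ring with two Hecke generators. -/

section AffineHecke

/-- Two invertible Hecke generators satisfying the braid relation, with inverses `s'`, `t'`, and
the element `ν` of the quadratic relations `s = s' + ν`, `t = t' + ν`. -/
structure HeckePair {M : Type*} [Ring M] (s s' t t' ν : M) : Prop where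
  s_mul : s * s' = 1
  mul_s : s' * s = 1
  t_mul : t * t' = 1
  mul_t : t' * t = 1
  braid : s * t * s = t * s * t
  quad_s : s = s' + ν
  quad_t : t = t' + ν
  central : ∀ z, ν * z = z * ν

namespace HeckePair

variable {M : Type*} [Ring M] {s s' t t' ν : M}

theorem inv (h : HeckePair s s' t t' ν) : HeckePair s' s t' t (-ν) where
  s_mul := h.mul_s
  mul_s := h.s_mul
  t_mul := h.mul_t
  mul_t := h.t_mul
  braid := by
    have h1 : (s' * t' * s') * (s * t * s) = 1 := by
      simp only [mul_assoc]
      rw [← mul_assoc s' s, h.mul_s, one_mul, ← mul_assoc t' t, h.mul_t, one_mul, h.mul_s]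
    have h2 : (s * t * s) * (t' * s' * t') = 1 := by
      rw [h.braid]
      simp only [mul_assoc]
      rw [← mul_assoc t t', h.t_mul, one_mul, ← mul_assoc s s', h.s_mul, one_mul, h.t_mul]
    exact left_inv_eq_right_inv h1 h2
  quad_s := by rw [h.quad_s]; abel
  quad_t := by rw [h.quad_t]; abel
  central := fun z => by rw [neg_mul, h.central, mul_neg]

theorem braid_assoc (h : HeckePair s s' t t' ν) (z : M) :
    t * (s * (t * z)) = s * (t * (s * z)) := by
  simp only [← mul_assoc, h.braid]

theorem s_mul_cancel (h : HeckePair s s' t t' ν) (z : M) : s * (s' * z) = z := by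
  rw [← mul_assoc, h.s_mul, one_mul]

theorem t_mul_cancel (h : HeckePair s s' t t' ν) (z : M) : t * (t' * z) = z := by
  rw [← mul_assoc, h.t_mul, one_mul]

theorem mul_s_cancel (h : HeckePair s s' t t' ν) (z : M) : s' * (s * z) = z := by
  rw [← mul_assoc, h.mul_s, one_mul]

theorem mul_t_cancel (h : HeckePair s s' t t' ν) (z : M) : t' * (t * z) = z := by
  rw [← mul_assoc, h.mul_t, one_mul]

theorem t_s_t' (h : HeckePair s s' t t' ν) (z : M) : t * (s * (t' * z)) = s' * (t * (s * z)) := by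
  rw [← h.mul_s_cancel (t * (s * (t' * z))), ← h.braid_assoc, h.t_mul_cancel]

/-- The balance of the inhomogeneous terms created when an element passes through a reflection
equation. With `t s t' = s' t s`, `t t = ν t + 1` and `s = s' + ν`, both sides become `s' t Z t s t
+ ν t Z t s t + t Z s t`. -/
theorem hecke_cancel (h : HeckePair s s' t t' ν) {Z : M} (hZ : Z * s = s * Z) :
    s * (t * (Z * (t * (s * t)))) + s * (t * (s * (t' * (Z * t))))
      = t * (Z * (t * (s * (t * s)))) + t * (s * (t' * (Z * (t * s)))) := by
  have hZ' : ∀ z, s * (Z * z) = Z * (s * z) := fun z => by rw [← mul_assoc, ← hZ, mul_assoc]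
  have e0 : s * (t * s) = t * (s * t) := by simpa only [mul_assoc] using h.braid
  have e1 : ∀ z, t * (t * z) = ν * (t * z) + z := fun z => by
    calc t * (t * z) = (t' + ν) * (t * z) := by rw [← h.quad_t]
      _ = _ := by rw [add_mul, h.mul_t_cancel, add_comm]
  have e2 : s * (t * (Z * (t * (s * t))))
      = s' * (t * (Z * (t * (s * t)))) + t * (Z * (ν * (t * (s * t)))) := by
    calc s * (t * (Z * (t * (s * t)))) = (s' + ν) * (t * (Z * (t * (s * t)))) := by rw [← h.quad_s]
      _ = _ := by rw [add_mul, h.central (t * _)]; simp only [mul_assoc, h.central]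
  rw [h.t_s_t', h.s_mul_cancel, h.t_s_t', hZ', hZ', e0, e1, e2]
  simp only [mul_add]
  abel

/-- The braid relation transports the reflection defect of `Z` for `t` to that of `t Z t` for `s`.
An operator `D` commuting with `s` can be moved through the latter using only its exchange relation
with `t Z t`. -/
theorem conj_reflection (h : HeckePair s s' t t' ν) {Z : M} (hZ : Z * s = s * Z) :
    t * s * (t * Z * t * Z - Z * t * Z * t) * s * t
      = s * (t * Z * t) * s * (t * Z * t) - (t * Z * t) * s * (t * Z * t) * s := by
  have hZ' : ∀ z, Z * (s * z) = s * (Z * z) := fun z => by rw [← mul_assoc, hZ, mul_assoc]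
  have e0 : t * (s * t) = s * (t * s) := by simpa only [mul_assoc] using h.braid.symm
  simp only [mul_sub, sub_mul, mul_assoc, h.braid_assoc, hZ', e0, hZ]

theorem conj_reflection' (h : HeckePair s s' t t' ν) {Z : M} (hZ : Z * s = s * Z) :
    t' * s' * (t * Z * t * Z - Z * t * Z * t) * s * t
      = s * (t' * Z * t) * s * (t' * Z * t) - (t' * Z * t) * s * (t' * Z * t) * s := by
  have hZ' : ∀ z, Z * (s * z) = s * (Z * z) := fun z => by rw [← mul_assoc, hZ, mul_assoc]
  have hZ'' : ∀ z, Z * (s' * z) = s' * (Z * z) := fun z => by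
    rw [← h.mul_s_cancel (Z * (s' * z)), ← hZ', h.s_mul_cancel]
  have e0 : t * (s * t) = s * (t * s) := by simpa only [mul_assoc] using h.braid.symm
  have e1 : ∀ z, s * (t' * (s' * z)) = t' * (s' * (t * z)) := fun z => by
    rw [← h.mul_t_cancel (s * (t' * (s' * z))), h.t_s_t', h.s_mul_cancel]
  simp only [mul_sub, sub_mul, mul_assoc, h.t_s_t', hZ', hZ'', hZ, e0, e1]

/-- Passing an element with inhomogeneous exchange relation through a reflection relation. -/
theorem pass_left (h : HeckePair s s' t t' ν) {D Z : M} (hD : D * s = s * D) (hZ : Z * s = s * Z)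
    (hx : D * (t' * Z * t) = t * Z * t * D + t) :
    D * (t' * s' * (t * Z * t * Z - Z * t * Z * t) * s * t)
      = t * s * (t * Z * t * Z - Z * t * Z * t) * s * t * D := by
  have key := h.hecke_cancel hZ
  rw [h.conj_reflection hZ, h.conj_reflection' hZ]
  have hD' : ∀ z, D * (s * z) = s * (D * z) := fun z => by rw [← mul_assoc, hD, mul_assoc]
  have hx' : ∀ z, D * ((t' * Z * t) * z) = t * Z * t * (D * z) + t * z := fun z => by
    rw [← mul_assoc, hx, add_mul, mul_assoc (t * Z * t)]
  -- Moving `D` past the two copies of `U` leaves one `t` for each copy; the four leftover terms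
  -- cancel by the third hypothesis, supplied by `hecke_cancel`.
  have e : ∀ U Y : M, D * U = Y * D + t → (∀ z, D * (U * z) = Y * (D * z) + t * z) →
      s * (Y * (s * t)) + s * (t * (s * U)) = Y * (s * t) * s + t * (s * (U * s)) →
      D * (s * U * s * U - U * s * U * s) = (s * Y * s * Y - Y * s * Y * s) * D := by
    intro U Y h1 h2 h3
    simp only [mul_sub, sub_mul, mul_assoc, hD', hD, h1, h2, mul_add]
    simp only [mul_assoc] at h3
    rw [add_assoc, h3]
    abel
  exact e _ _ hx hx' (by simpa only [mul_assoc] using key)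

/-- Mirror image of `pass_left`, used when `Z` consists of annihilation operators and `D` of
creation operators. -/
theorem pass_right (h : HeckePair s s' t t' ν) {D Z : M} (hD : D * s = s * D) (hZ : Z * s = s * Z)
    (hx : t * Z * t * D = D * (t' * Z * t) + t) :
    t * s * (t * Z * t * Z - Z * t * Z * t) * s * t * D
      = D * (t' * s' * (t * Z * t * Z - Z * t * Z * t) * s * t) := by
  have key := h.hecke_cancel hZ
  rw [h.conj_reflection hZ, h.conj_reflection' hZ]
  have e : ∀ U Y : M, Y * D = D * U + t →
      s * (Y * (s * t)) + s * (t * (s * U)) = Y * (s * t) * s + t * (s * (U * s)) →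
      (s * Y * s * Y - Y * s * Y * s) * D = D * (s * U * s * U - U * s * U * s) := by
    intro U Y h1 h3
    have h1' : ∀ z, Y * (D * z) = D * (U * z) + t * z := fun z => by
      rw [← mul_assoc, h1, add_mul, mul_assoc]
    have hD' : ∀ z, s * (D * z) = D * (s * z) := fun z => by rw [← mul_assoc, ← hD, mul_assoc]
    simp only [mul_sub, sub_mul, mul_assoc, hD', ← hD, h1, h1', mul_add]
    simp only [mul_assoc] at h3
    rw [sub_eq_sub_iff_add_eq_add]
    have := congrArg (fun w => D * (s * (U * (s * U))) + w + D * (U * (s * (U * s)))) h3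
    convert this using 1 <;> abel
  exact e _ _ hx (by simpa only [mul_assoc] using key)

end HeckePair

end AffineHecke

/-! ### Construction of the annihilation operators. -/

section Fock

variable {K : Type*} [CommRing K]

/-- Freeness allows a recursion that uses both `f` and `N f`: each letter `g` acts on pairs by `(f,
m) ↦ (g f, Φ g (f, m))`, this extends to the free algebra, and `N f` is the second component of `f`
acting on `(1, 0)`. -/
theorem exists_linear_recursion {G M : Type*} [AddCommGroup M] [Module K M]
    (Φ : G → (FreeAlgebra K G × M) →ₗ[K] M) :
    ∃ N : FreeAlgebra K G →ₗ[K] M, N 1 = 0 ∧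
      ∀ g f, N (FreeAlgebra.ι K g * f) = Φ g (f, N f) := by
  let T : G → Module.End K (FreeAlgebra K G × M) := fun g =>
    LinearMap.prod (LinearMap.mulLeft K (FreeAlgebra.ι K g) ∘ₗ LinearMap.fst K _ _) (Φ g)
  let L := FreeAlgebra.lift K T
  have hL : ∀ f p, (L f p).1 = f * p.1 := by
    intro f
    induction f using FreeAlgebra.induction with
    | grade0 r => intro p; simp [Algebra.smul_def]
    | grade1 g => intro p; simp [L, T]
    | mul a b ha hb => intro p; simp [ha, hb, mul_assoc]
    | add a b ha hb => intro p; simp [ha, hb, add_mul]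
  refine ⟨LinearMap.snd K _ _ ∘ₗ LinearMap.applyₗ ((1 : FreeAlgebra K G), (0 : M)) ∘ₗ
    L.toLinearMap, by simp, fun g f => ?_⟩
  have h1 : L f (1, 0) = (f, (L f (1, 0)).2) := Prod.ext (by simp [hL]) rfl
  have h2 : L (FreeAlgebra.ι K g * f) (1, 0) = T g (L f (1, 0)) := by simp [L]
  simp only [LinearMap.comp_apply, LinearMap.applyₗ_apply_apply, AlgHom.toLinearMap_apply, h2,
    LinearMap.snd_apply]
  conv_lhs => rw [h1]
  rfl

variable {ι : Type*} [Fintype ι] [LinearOrder ι]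

/-- The matrix of creation operators: left multiplications by the letters. -/
def creation (K ι : Type*) [CommRing K] :
    Matrix ι ι (Module.End K (FreeAlgebra K (ι × ι))) :=
  Matrix.of fun i j => LinearMap.mulLeft K (FreeAlgebra.ι K (i, j))

theorem exchange_apply {B : Type*} [Ring B] [Algebra K B] (q qi : K) (C N : Matrix ι ι B)
    (a b c d : ι) :
    (scalars B (ι × ι) (brd (· > ·) qi q) *
        (inLast ι C * scalars B (ι × ι) (brd (· > ·) qi q) * inLast ι N)
      * scalars B (ι × ι) (brd (· < ·) q qi)) (a, b) (c, d)
    = (if c = d then q else 1) • ((if a = b then qi else 1) •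
        ((if b = d then qi else 1) • (C a d * N b c)
          + (if b = d then qi - q else 0) • ∑ e with e > b, C a e * N e c)
        + (if b > a then qi - q else 0) • ((if a = d then qi else 1) • (C b d * N a c)
          + (if a = d then qi - q else 0) • ∑ e with e > a, C b e * N e c))
      + (if d < c then q - qi else 0) • ((if a = b then qi else 1) •
        ((if b = c then qi else 1) • (C a c * N b d)
          + (if b = c then qi - q else 0) • ∑ e with e > b, C a e * N e d)
        + (if b > a then qi - q else 0) • ((if a = c then qi else 1) • (C b c * N a d)
          + (if a = c then qi - q else 0) • ∑ e with e > a, C b e * N e d)) := by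
  rw [mul_brd_apply, brd_mul_apply, brd_mul_apply]
  simp only [sandwich_apply]

/-- The triangular matrix governing the diagonal part of the exchange relation. -/
def triMat (ι : Type*) [LinearOrder ι] (q qi : K) : Matrix ι ι K :=
  Matrix.of fun a e => (if a = e then q else 0) + (if e < a then q - qi else 0)

theorem triMat_mul_inv {q qi : K} (h : q * qi = 1) : triMat ι q qi * (triMat ι q qi)⁻¹ = 1 := by
  apply Matrix.mul_nonsing_inv
  rw [Matrix.det_of_isLowerTriangular]
  · simp only [triMat, Matrix.of_apply, lt_irrefl, if_true, if_false, add_zero, Finset.prod_const]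
    exact (IsUnit.of_mul_eq_one _ h).pow _
  · intro i j hij
    have hij : i < j := hij
    simp [triMat, hij.ne, hij.not_gt]

/-- The right-hand side at `f` involves only `f` and `N f`, so the relation can be solved for `N` on
a word one letter longer. For `a ≠ c` each entry gives one value directly; for `a = c` the values
form a linear system with the invertible matrix `triMat`. -/
theorem exists_annihilation {q qi : K} (h : q * qi = 1) :
    ∃ N : Matrix ι ι (Module.End K (FreeAlgebra K (ι × ι))),
      (∀ i j, N i j 1 = 0) ∧
      inLast ι N * scalars _ _ (brd (· < ·) q qi) * inLast ι (creation K ι)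
        = scalars _ _ (brd (· > ·) qi q) * (inLast ι (creation K ι) *
          scalars _ _ (brd (· > ·) qi q) * inLast ι N) * scalars _ _ (brd (· < ·) q qi) + 1 := by
  let F := FreeAlgebra K (ι × ι)
  let Q := F × (ι → ι → F)
  -- In a pair `(f, m)` the component `m` stands for the still unknown matrix `N f`. With these
  -- operators the right-hand side of the relation becomes a linear function of the pair.
  let C' : Matrix ι ι (Module.End K Q) := Matrix.of fun i j =>
    LinearMap.inl K _ _ ∘ₗ creation K ι i j ∘ₗ LinearMap.fst K _ _
  let N' : Matrix ι ι (Module.End K Q) := Matrix.of fun i j =>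
    LinearMap.inl K _ _ ∘ₗ LinearMap.proj j ∘ₗ LinearMap.proj i ∘ₗ LinearMap.snd K _ _
  let Rh := scalars (Module.End K Q) _ (brd (ι := ι) (· > ·) qi q) * (inLast ι C' *
          scalars _ _ (brd (· > ·) qi q) * inLast ι N') * scalars _ _ (brd (· < ·) q qi) + 1
  let ρ : ι → ι → ι → ι → Q →ₗ[K] F := fun a b c d => LinearMap.fst K _ _ ∘ₗ Rh (a, b) (c, d)
  let Φ : ι × ι → Q →ₗ[K] (ι → ι → F) := fun g => LinearMap.pi fun b => LinearMap.pi fun c =>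
    if g.1 = c then ∑ e, (triMat ι q qi)⁻¹ g.1 e • ρ e b e g.2 else ρ g.1 b c g.2
  obtain ⟨N, hN1, hN⟩ := exists_linear_recursion Φ
  let Nm : Matrix ι ι (Module.End K F) := Matrix.of fun i j =>
    LinearMap.proj j ∘ₗ LinearMap.proj i ∘ₗ N
  refine ⟨Nm, fun i j => by simp [Nm, hN1], ?_⟩
  have hρ : ∀ a b c d f, ρ a b c d (f, N f) = (scalars _ _ (brd (· > ·) qi q) *
      (inLast ι (creation K ι) * scalars _ _ (brd (· > ·) qi q) * inLast ι Nm) *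
        scalars _ _ (brd (· < ·) q qi) + 1 : Matrix _ _ (Module.End K F)) (a, b) (c, d) f := by
    intro a b c d f
    have h1 : ∀ x y z w, LinearMap.fst K F (ι → ι → F) ((C' x y * N' z w) (f, N f))
        = (creation K ι x y * Nm z w) f := fun _ _ _ _ => rfl
    have h2 : LinearMap.fst K F (ι → ι → F)
          ((1 : Matrix (ι × ι) (ι × ι) (Module.End K Q)) (a, b) (c, d) (f, N f))
        = (1 : Matrix (ι × ι) (ι × ι) (Module.End K F)) (a, b) (c, d) f := by
      simp only [Matrix.one_apply]; split_ifs <;> rfl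
    simp only [ρ, Rh, LinearMap.comp_apply, Matrix.add_apply, LinearMap.add_apply, map_add, h2]
    congr 1
    rw [exchange_apply, exchange_apply]
    simp only [LinearMap.add_apply, LinearMap.smul_apply, LinearMap.sum_apply, map_add, map_smul,
      map_sum, h1]
  ext1 ⟨a, b⟩ ⟨c, d⟩
  refine LinearMap.ext fun f => ?_
  rw [← hρ, sandwich_apply]
  have hval : ∀ a b c d, (Nm b c * creation K ι a d) f
      = if a = c then ∑ e, (triMat ι q qi)⁻¹ a e • ρ e b e d (f, N f)
        else ρ a b c d (f, N f) := by
    intro a b c d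
    have : (Nm b c * creation K ι a d) f = Φ (a, d) (f, N f) b c := by
      simp only [Nm, creation, Module.End.mul_apply, Matrix.of_apply, LinearMap.comp_apply,
        LinearMap.proj_apply, LinearMap.mulLeft_apply, hN]
    rw [this]
    by_cases hac : a = c
    · simp [Φ, hac]
    · simp [Φ, hac]
  by_cases hac : a = c
  · subst hac
    have e1 : ∀ e, (Nm b e * creation K ι e d) f
        = ∑ e', (triMat ι q qi)⁻¹ e e' • ρ e' b e' d (f, N f) := fun e => by rw [hval, if_pos rfl]
    have e2 : ((if a = a then q else 1) • (Nm b a * creation K ι a d)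
        + (if a = a then q - qi else 0) • ∑ e with e < a, Nm b e * creation K ι e d) f
        = ∑ e, triMat ι q qi a e • (Nm b e * creation K ι e d) f := by
      simp only [if_true, LinearMap.add_apply, LinearMap.smul_apply, LinearMap.sum_apply, triMat,
        Matrix.of_apply, add_smul, Finset.sum_add_distrib, ite_smul, zero_smul, Finset.sum_ite_eq,
        Finset.mem_univ, Finset.smul_sum]
      simp only [Finset.sum_filter]
    rw [e2]
    simp only [e1, Finset.smul_sum, smul_smul]
    rw [Finset.sum_comm]
    simp only [← Finset.sum_smul, ← Matrix.mul_apply, triMat_mul_inv h]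
    simp [Matrix.one_apply]
  · have := hval a b c d
    simp only [hac, if_false] at this
    simp [hac, ← this]

end Fock

/-! ### The annihilation operators satisfy the reflection equation. -/

section FockQuotient

variable {K : Type*} [CommRing K] {ι : Type*} [Fintype ι] [LinearOrder ι]

theorem heckePair (B : Type*) [Ring B] [Algebra K B] {q qi : K} (h : q * qi = 1) :
    HeckePair (scalars B (ι × ι × ι) (brdFst (· < ·) q qi))
      (scalars B (ι × ι × ι) (brdFst (· > ·) qi q))
      (inLast ι (scalars B (ι × ι) (brd (· < ·) q qi)))
      (inLast ι (scalars B (ι × ι) (brd (· > ·) qi q)))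
      (scalars B (ι × ι × ι) ((q - qi) • (1 : Matrix (ι × ι × ι) (ι × ι × ι) K))) where
  s_mul := by rw [← map_mul, brdFst_mul_inv h, map_one]
  mul_s := by rw [← map_mul, mul_eq_one_comm.mp (brdFst_mul_inv h), map_one]
  t_mul := by rw [← map_mul, ← map_mul, brd_mul_brd_inv h, map_one, map_one]
  mul_t := by rw [← map_mul, ← map_mul, brd_inv_mul_brd h, map_one, map_one]
  braid := by simp only [← scalars_inLast, ← map_mul, braid_relation h]
  quad_s := by rw [← map_add, brdFst_inv_eq]; simp
  quad_t := by
    rw [← scalars_inLast, ← scalars_inLast, ← map_add, brd_inv_eq, map_sub]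
    congr 1
    have : inLast ι ((q - qi) • (1 : Matrix (ι × ι) (ι × ι) K)) = (q - qi) • 1 := by
      ext ⟨a, b⟩ ⟨c, d⟩
      by_cases h1 : a = c <;> by_cases h2 : b = d <;> simp [inLast_apply, h1, h2]
    rw [this, sub_add_cancel]
  central z := by
    have : scalars B (ι × ι × ι) ((q - qi) • (1 : Matrix (ι × ι × ι) (ι × ι × ι) K)) = (q - qi) • 1 := by
      ext i j
      by_cases h1 : i = j <;> simp [Algebra.algebraMap_eq_smul_one, h1, sub_smul]
    rw [this, smul_mul_assoc, mul_smul_comm, one_mul, mul_one]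

/-- The operators on the free algebra on the matrix entries. -/
abbrev FockEnd (K ι : Type*) [CommRing K] : Type _ := Module.End K (FreeAlgebra K (ι × ι))

/-- The exchange relation between annihilation and creation operators. -/
def Exchange (q qi : K) (N : Matrix ι ι (FockEnd K ι)) : Prop :=
  inLast ι N * scalars (FockEnd K ι) (ι × ι) (brd (· < ·) q qi) * inLast ι (creation K ι)
    = scalars (FockEnd K ι) (ι × ι) (brd (· > ·) qi q) * (inLast ι (creation K ι) *
      scalars (FockEnd K ι) (ι × ι) (brd (· > ·) qi q) * inLast ι N) *
        scalars (FockEnd K ι) (ι × ι) (brd (· < ·) q qi) + 1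

/-- The defect of the reflection equation. -/
def reflection {B : Type*} [Ring B] [Algebra K B] (r : ι → ι → Prop) [DecidableRel r] (q qi : K)
    (Z : Matrix ι ι B) : Matrix (ι × ι) (ι × ι) B :=
  scalars B _ (brd r q qi) * inLast ι Z * scalars B _ (brd r q qi) * inLast ι Z
    - inLast ι Z * scalars B _ (brd r q qi) * inLast ι Z * scalars B _ (brd r q qi)

variable {q qi : K} {N : Matrix ι ι (FockEnd K ι)}

theorem isUnit_weight {ι K : Type*} [DecidableEq ι] [CommRing K] {q qi : K} (h : q * qi = 1)
    (a b : ι) : IsUnit (if a = b then q else 1) := by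
  split_ifs
  · exact IsUnit.of_mul_eq_one _ h
  · exact isUnit_one

theorem inLast_reflection {B : Type*} [Ring B] [Algebra K B] (r : ι → ι → Prop) [DecidableRel r]
    (Z : Matrix ι ι B) :
    inLast ι (reflection r q qi Z)
      = inLast ι (scalars B _ (brd r q qi)) * inLast ι (inLast ι Z)
          * inLast ι (scalars B _ (brd r q qi)) * inLast ι (inLast ι Z)
        - inLast ι (inLast ι Z) * inLast ι (scalars B _ (brd r q qi)) * inLast ι (inLast ι Z)
          * inLast ι (scalars B _ (brd r q qi)) := by
  simp only [reflection, map_sub, map_mul]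

theorem mul_apply_mem {m : Type*} [Fintype m] {V : Type*} [AddCommGroup V]
    [Module K V] (I : Submodule K V) {M M' : Matrix m m (Module.End K V)} (v : V)
    (hM : ∀ i j, ∀ w ∈ I, M i j w ∈ I) (hM' : ∀ i j, M' i j v ∈ I) (i j : m) :
    (M * M') i j v ∈ I := by
  rw [Matrix.mul_apply, LinearMap.sum_apply]
  exact Submodule.sum_mem _ fun e _ => hM _ _ _ (hM' _ _)

theorem mul_scalars_apply_mem {m : Type*} [Fintype m] [DecidableEq m] {V : Type*} [AddCommGroup V]
    [Module K V] (I : Submodule K V) {M : Matrix m m (Module.End K V)} {S : Matrix m m K} (v : V)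
    (hM : ∀ i j, M i j v ∈ I) (i j : m) : (M * scalars (Module.End K V) m S) i j v ∈ I := by
  rw [Matrix.mul_apply, LinearMap.sum_apply]
  refine Submodule.sum_mem _ fun e _ => ?_
  rw [RingHom.mapMatrix_apply, Matrix.map_apply, ← Algebra.commutes, ← Algebra.smul_def]
  exact I.smul_mem _ (hM _ _)

theorem scalars_apply_mem {m : Type*} [Fintype m] [DecidableEq m] {V : Type*} [AddCommGroup V]
    [Module K V] (I : Submodule K V) {S : Matrix m m K} (i j : m) (w : V) (hw : w ∈ I) :
    scalars (Module.End K V) m S i j w ∈ I := by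
  rw [RingHom.mapMatrix_apply, Matrix.map_apply, Module.algebraMap_end_apply]
  exact I.smul_mem _ hw

theorem inLast_apply_mem {m : Type*} [Fintype m] [DecidableEq m] {V : Type*} [AddCommGroup V]
    [Module K V] (I : Submodule K V) {M : Matrix m m (Module.End K V)} (v : V)
    (hM : ∀ i j, M i j v ∈ I) (i j : ι × m) : inLast ι M i j v ∈ I := by
  obtain ⟨a, i⟩ := i
  obtain ⟨b, j⟩ := j
  rw [inLast_apply]
  split_ifs
  · exact hM _ _
  · simp

/-- By `pass_right`, the defect `Δ` of `N` followed by creation equals a product that first applies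
`Δ`, up to scalar matrices. So if `Δ` kills `f`, it kills scalar combinations of the `C a z f`, and
triangularity isolates each of them. -/
theorem reflection_creation_step (h : q * qi = 1) (hN : Exchange q qi N)
    {f : FreeAlgebra K (ι × ι)} (hf : ∀ u v, reflection (· < ·) q qi N u v f = 0) (a z : ι)
    (u v : ι × ι) : reflection (· < ·) q qi N u v (creation K ι a z f) = 0 := by
  set C := creation K ι
  have H := heckePair (ι := ι) (FockEnd K ι) h
  set b := scalars (FockEnd K ι) (ι × ι) (brd (· < ·) q qi) with hb
  set b' := scalars (FockEnd K ι) (ι × ι) (brd (· > ·) qi q) with hb'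
  have hbb' : b * b' = 1 := by rw [← map_mul, brd_mul_brd_inv h, map_one]
  have hx : b * inLast ι N * b * inLast ι C = inLast ι C * (b' * inLast ι N * b) + b := by
    have := congrArg (b * ·) hN
    simp only [mul_add, mul_one] at this
    simp only [← mul_assoc] at this ⊢
    rw [this, hbb', one_mul]
  have hx3 := congrArg (inLast ι) hx
  simp only [map_mul, map_add] at hx3
  have key := H.pass_right (brdFst_comm_inLast _ _ _ _).symm (brdFst_comm_inLast _ _ _ _).symm hx3
  rw [← inLast_reflection] at key
  set Δ := reflection (· < ·) q qi N
  set s := scalars (FockEnd K ι) (ι × ι × ι) (brdFst (· < ·) q qi)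
  set s' := scalars (FockEnd K ι) (ι × ι × ι) (brdFst (· > ·) qi q)
  have key2 : inLast ι Δ * (s * (inLast ι b * inLast ι (inLast ι C)))
      = s' * inLast ι b' * inLast ι (inLast ι C) * (inLast ι b' * s') * inLast ι Δ
        * scalars (FockEnd K ι) (ι × ι × ι) (brdFst (· < ·) q qi * inLast ι (brd (· < ·) q qi)) := by
    have := congrArg (fun m => s' * (inLast ι b' * m)) key
    simp only [mul_assoc, H.mul_t_cancel, H.mul_s_cancel] at this
    rw [this, map_mul, scalars_inLast]
    simp only [mul_assoc]
    rfl
  have hzero : ∀ i j, (inLast ι Δ * (s * (inLast ι b * inLast ι (inLast ι C)))) i j f = 0 := by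
    intro i j
    rw [key2, ← Submodule.mem_bot K]
    refine mul_scalars_apply_mem _ _ (mul_apply_mem _ _ ?_ (inLast_apply_mem _ _ ?_)) _ _
    · intro i j w hw
      rw [Submodule.mem_bot] at hw; simp [hw]
    · intro i j; rw [Submodule.mem_bot]; exact hf i j
  induction a using WellFoundedLT.induction generalizing u v z with
  | ind a ih =>
  obtain ⟨z0, z1⟩ := v
  have h0 := hzero (a, u) (z0, z1, z)
  rw [inLast_mul_apply, LinearMap.sum_apply] at h0
  -- Only the leading part of `s b C` remains: the corrections contain creation operators of smaller
  -- row index, already treated by induction.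
  have hterm : ∀ e : ι × ι,
      (Δ u e * (s * (inLast ι b * inLast ι (inLast ι C))) (a, e) (z0, z1, z)) f
      = if e = (z0, z1) then ((if a = z0 then q else 1) * (if a = z1 then q else 1))
          • Δ u (z0, z1) (C a z f) else 0 := by
    rintro ⟨x, y⟩
    rw [brdFst_mul_apply, ← map_mul]
    simp only [inLast_apply, brd_mul_apply, b]
    have ih' : ∀ c, c < a → ∀ v z, (Δ u v) (C c z f) = 0 := fun c hc v z => ih c hc z u v
    have e1 : ∀ (p : Prop) [Decidable p] (T : FockEnd K ι),
        (if p then T else 0) = (if p then (1 : K) else 0) • T := by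
      intro p _ T; split_ifs <;> simp
    simp only [Module.End.mul_apply, LinearMap.add_apply, LinearMap.smul_apply, e1, map_add,
      map_smul, smul_add]
    trans (if a = x then q else 1) • (if x = z0 then (1 : K) else 0) • (if a = y then q else 1) •
      (if y = z1 then (1 : K) else 0) • (Δ u (x, y)) (C a z f)
    · by_cases h3 : x < a <;> by_cases h4 : y < a
      · simp only [ih' x h3, ih' y h4, smul_zero, add_zero]
      · have h5 : ¬ y < x := fun h5 => h4 (h5.trans h3)
        simp only [ih' x h3, h4, h5, smul_zero, add_zero, if_false, zero_smul]
      · simp only [ih' y h4, h3, smul_zero, add_zero, if_false, zero_smul]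
      · simp only [h3, h4, smul_zero, add_zero, if_false, zero_smul]
    · by_cases h1 : x = z0 <;> by_cases h2 : y = z1 <;> simp [h1, h2, smul_smul]
  simp only [hterm, Finset.sum_ite_eq', Finset.mem_univ, if_true] at h0
  exact ((((isUnit_weight h a z0).mul (isUnit_weight h a z1)).smul_eq_zero).mp h0)

/-- The defect kills the vacuum `1`, since each of its terms first applies some `N i j`, up to
scalars; and its vanishing propagates along left multiplication by letters. -/
theorem reflection_annihilation (h : q * qi = 1) (hN : Exchange q qi N)
    (hN1 : ∀ i j, N i j 1 = 0) : reflection (· < ·) q qi N = 0 := by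
  suffices H : ∀ f u v, reflection (· < ·) q qi N u v f = 0 by
    ext1 u v; exact LinearMap.ext fun f => H f u v
  have hmul : ∀ a f, (∀ u v, reflection (· < ·) q qi N u v f = 0) →
      ∀ u v, reflection (· < ·) q qi N u v (a * f) = 0 := by
    intro a
    induction a using FreeAlgebra.induction with
    | grade0 r => intro f hf u v; rw [← Algebra.smul_def, map_smul, hf, smul_zero]
    | grade1 g => intro f hf u v; exact reflection_creation_step h hN hf g.1 g.2 u v
    | mul a b ha hb => intro f hf u v; rw [mul_assoc]; exact ha _ (hb _ hf) u v
    | add a b ha hb => intro f hf u v; rw [add_mul, map_add, ha _ hf, hb _ hf, add_zero]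
  intro f u v
  rw [← mul_one f]
  refine hmul f 1 (fun u v => ?_) u v
  rw [← Submodule.mem_bot K, reflection, Matrix.sub_apply, LinearMap.sub_apply]
  have h1 : ∀ i j, inLast ι N i j 1 ∈ (⊥ : Submodule K (FreeAlgebra K (ι × ι))) :=
    inLast_apply_mem _ _ fun i j => by rw [Submodule.mem_bot]; exact hN1 i j
  have h2 : ∀ (M : Matrix (ι × ι) (ι × ι) (FockEnd K ι)), ∀ i j, ∀ w ∈ (⊥ : Submodule K _),
      M i j w ∈ (⊥ : Submodule K _) := fun M i j w hw => by
    rw [Submodule.mem_bot] at hw ⊢; rw [hw, map_zero]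
  refine Submodule.sub_mem _ (mul_apply_mem _ _ (h2 _) h1 _ _) ?_
  exact mul_scalars_apply_mem _ _ (mul_apply_mem _ _ (h2 _) h1) _ _

end FockQuotient

/-! ### The annihilation operators preserve the ideal of reflection relations. -/

section FockIdeal

variable {K : Type*} [CommRing K] {ι : Type*} [Fintype ι] [LinearOrder ι]
  {q qi : K} {N : Matrix ι ι (FockEnd K ι)}

/-- Dual to `reflection_creation_step`: `pass_left` for the inverse Hecke pair moves `N` through the
defect of the creation operators, so that after the move the defect is applied last, up to scalars,
and the result lies in `I`. -/
theorem annihilation_reflection_mem (h : q * qi = 1) (hN : Exchange q qi N)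
    (I : Submodule K (FreeAlgebra K (ι × ι)))
    (hI : ∀ u v f, reflection (· > ·) qi q (creation K ι) u v f ∈ I) (c z : ι) (u v : ι × ι)
    (f : FreeAlgebra K (ι × ι)) :
    N c z (reflection (· > ·) qi q (creation K ι) u v f) ∈ I := by
  set C := creation K ι
  have H := heckePair (ι := ι) (FockEnd K ι) h
  set b := scalars (FockEnd K ι) (ι × ι) (brd (· < ·) q qi) with hb
  set b' := scalars (FockEnd K ι) (ι × ι) (brd (· > ·) qi q) with hb'
  have hbb' : b * b' = 1 := by rw [← map_mul, brd_mul_brd_inv h, map_one]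
  have hx : inLast ι N * (b * inLast ι C * b') = b' * inLast ι C * b' * inLast ι N + b' := by
    have := congrArg (· * b') hN
    simp only [add_mul, one_mul] at this
    simp only [mul_assoc] at this ⊢
    rw [this, hbb', mul_one]
  have hx3 := congrArg (inLast ι) hx
  simp only [map_mul, map_add] at hx3
  have key := H.inv.pass_left (brdFst_comm_inLast _ _ _ _).symm
    (brdFst_comm_inLast _ _ _ _).symm hx3
  rw [← inLast_reflection] at key
  set ρ := reflection (· > ·) qi q C
  set s := scalars (FockEnd K ι) (ι × ι × ι) (brdFst (· < ·) q qi)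
  set s' := scalars (FockEnd K ι) (ι × ι × ι) (brdFst (· > ·) qi q)
  have key2 : inLast ι (inLast ι N) * (inLast ι b * (s * inLast ι ρ))
      = scalars (FockEnd K ι) (ι × ι × ι) (inLast ι (brd (· > ·) qi q) * brdFst (· > ·) qi q)
        * (inLast ι ρ * (s' * (inLast ι b' * (inLast ι (inLast ι N) * (inLast ι b * s))))) := by
    have := congrArg (fun m => m * inLast ι b * s) key
    simp only [mul_assoc, H.mul_t, H.mul_s, mul_one] at this
    rw [this, map_mul, scalars_inLast]
    simp only [mul_assoc]
    rfl
  have hmem : ∀ i j f, (inLast ι (inLast ι N) * (inLast ι b * (s * inLast ι ρ))) i j f ∈ I := by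
    intro i j f
    rw [key2]
    refine mul_apply_mem I f (fun i j w hw => scalars_apply_mem I i j w hw) ?_ i j
    intro i j
    rw [Matrix.mul_apply, LinearMap.sum_apply]
    refine Submodule.sum_mem _ fun e _ => ?_
    rw [Module.End.mul_apply]
    generalize (s' * (inLast ι b' * (inLast ι (inLast ι N) * (inLast ι b * s)))) e j f = g
    exact inLast_apply_mem I g (fun i j => hI i j g) i e
  -- The entry of `hmem` in row `(x, y, c)` and column `(z, v)` is a unit multiple of the wanted
  -- element plus terms `N c e` with `e < z`.
  induction z using WellFoundedLT.induction generalizing u v with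
  | ind z ih =>
  obtain ⟨x, y⟩ := u
  have h0 := hmem (x, y, c) (z, v) f
  rw [inLast_mul_apply, Fintype.sum_prod_type] at h0
  simp only [inLast_apply, ite_mul, zero_mul] at h0
  rw [Finset.sum_eq_single y (fun e _ he => by simp [he.symm]) (by simp)] at h0
  simp only [if_true, LinearMap.sum_apply] at h0
  have e1 : ∀ (p : Prop) [Decidable p] (T : FockEnd K ι),
      (if p then T else 0) = (if p then (1 : K) else 0) • T := by
    intro p _ T; split_ifs <;> simp
  have hb2 : ∀ (e : ι) (M : Matrix (ι × ι × ι) (ι × ι × ι) (FockEnd K ι)) j,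
      (inLast ι b * M) (x, (y, e)) j
        = (if y = e then q else 1) • M (x, e, y) j + (if e < y then q - qi else 0) • M (x, y, e) j := by
    intro e M j
    rw [inLast_mul_apply]
    exact brd_mul_apply _ q qi (Matrix.of fun w k => M (x, w) k) y e j
  have hterm : ∀ e : ι, (N c e * (inLast ι b * (s * inLast ι ρ)) (x, y, e) (z, v)) f
      - (if e = z then ((if y = z then q else 1) * (if x = z then q else 1)) •
          N c z (ρ (x, y) v f) else 0) ∈ I := by
    intro e
    have hcond : ∀ (p : Prop) [Decidable p], (p → e < z) → ∀ u, (if p then (1 : K) else 0) •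
        N c e (ρ u v f) ∈ I := by
      intro p _ hp u
      split_ifs with hp'
      · exact I.smul_mem _ (ih e (hp hp') u v)
      · simp
    have hcond2 : ∀ (k : K) (p p' : Prop) [Decidable p] [Decidable p'], (p → p' → e < z) → ∀ u,
        (if p then k else 0) • (if p' then (1 : K) else 0) • N c e (ρ u v f) ∈ I := by
      intro k p p' _ _ hp u
      by_cases h1 : p
      · exact I.smul_mem _ (hcond _ (fun h2 => hp h1 h2) u)
      · simp [h1]
    simp only [hb2, s, brdFst_mul_apply, inLast_apply, e1, Module.End.mul_apply,
      LinearMap.add_apply, LinearMap.smul_apply, map_add, map_smul, smul_add]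
    have h1 : ∀ A B C D E : FreeAlgebra K (ι × ι), A - E = 0 → B ∈ I → C ∈ I → D ∈ I →
        A + B + (C + D) - E ∈ I := by
      intro A B C D E h1 h2 h3 h4
      have : A + B + (C + D) - E = (A - E) + B + (C + D) := by abel
      rw [this, h1, zero_add]
      exact I.add_mem h2 (I.add_mem h3 h4)
    refine h1 _ _ _ _ _ ?_ ?_ ?_ ?_
    · by_cases h2 : e = z
      · subst h2; simp [smul_smul]
      · simp [h2]
    · exact I.smul_mem _ (hcond2 _ _ _ (fun h2 h3 => by rwa [h3] at h2) _)
    · rw [smul_comm]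
      exact I.smul_mem _ (hcond2 _ _ _ (fun h2 h3 => by rwa [h3] at h2) _)
    · rw [smul_comm]
      by_cases h2 : y < x
      · exact I.smul_mem _ (hcond2 _ _ _ (fun h3 h4 => by rw [← h4]; exact h3.trans h2) _)
      · simp [h2]
  have h1 := I.sub_mem h0 (I.sum_mem fun e (_ : e ∈ Finset.univ) => hterm e)
  rw [← Finset.sum_sub_distrib] at h1
  simp only [sub_sub_cancel, Finset.sum_ite_eq', Finset.mem_univ, if_true] at h1
  obtain ⟨w, hw⟩ := (isUnit_weight h y z).mul (isUnit_weight h x z)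
  rw [← hw] at h1
  have := I.smul_mem (↑w⁻¹ : K) h1
  rwa [smul_smul, Units.inv_mul, one_smul] at this

theorem annihilation_creation_mem (h : q * qi = 1) (hN : Exchange q qi N)
    (I : Submodule K (FreeAlgebra K (ι × ι))) (hC : ∀ i j, ∀ g ∈ I, creation K ι i j g ∈ I)
    {g : FreeAlgebra K (ι × ι)} (hg : g ∈ I) (hNg : ∀ i j, N i j g ∈ I) (a b c d : ι) :
    N b c (creation K ι a d g) ∈ I := by
  have hmem : ∀ i j, (inLast ι N * scalars (FockEnd K ι) (ι × ι) (brd (· < ·) q qi)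
      * inLast ι (creation K ι)) i j g ∈ I := by
    intro i j
    rw [hN, Matrix.add_apply, LinearMap.add_apply]
    refine I.add_mem (mul_scalars_apply_mem I g (mul_apply_mem I g
      (fun i j w hw => scalars_apply_mem I i j w hw) fun i j => ?_) i j) ?_
    · rw [mul_assoc]
      refine mul_apply_mem I g (fun i j w hw => inLast_apply_mem I w (fun _ _ => hC _ _ _ hw) _ _)
        (mul_apply_mem I g (fun i j w hw => scalars_apply_mem I i j w hw)
          (inLast_apply_mem I g hNg)) _ _
    · rw [Matrix.one_apply]
      split_ifs
      · exact hg
      · exact I.zero_mem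
  induction a using WellFoundedLT.induction generalizing b c with
  | ind a ih =>
  have h1 := hmem (a, b) (c, d)
  rw [sandwich_apply, LinearMap.add_apply] at h1
  have h2 : ((if a = c then q - qi else 0) • ∑ e with e < a, N b e * creation K ι e d) g ∈ I := by
    rw [LinearMap.smul_apply, LinearMap.sum_apply]
    refine I.smul_mem _ (I.sum_mem fun e he => ih e (by simpa using he) b e)
  have h3 := (I.add_mem_iff_left h2).mp h1
  obtain ⟨w, hw⟩ := isUnit_weight h a c
  rw [← hw] at h3
  have := I.smul_mem (↑w⁻¹ : K) h3
  rwa [LinearMap.smul_apply, smul_smul, Units.inv_mul, one_smul] at this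

/-- The submodule generated by the reflection relations. -/
def reflectionIdeal (ι : Type*) [Fintype ι] [LinearOrder ι] (q qi : K) :
    Submodule K (FreeAlgebra K (ι × ι)) :=
  Submodule.span K {g | ∃ a f u v, g = a * reflection (· > ·) qi q (creation K ι) u v f}

theorem mul_mem_reflectionIdeal (a : FreeAlgebra K (ι × ι)) {g : FreeAlgebra K (ι × ι)}
    (hg : g ∈ reflectionIdeal ι q qi) : a * g ∈ reflectionIdeal ι q qi := by
  induction hg using Submodule.span_induction with
  | mem g hg =>
    obtain ⟨a', f, u, v, rfl⟩ := hg
    exact Submodule.subset_span ⟨a * a', f, u, v, by rw [mul_assoc]⟩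
  | zero => simp
  | add x y _ _ hx hy => rw [mul_add]; exact Submodule.add_mem _ hx hy
  | smul c x _ hx => rw [mul_smul_comm]; exact Submodule.smul_mem _ _ hx

theorem reflection_mem (u v : ι × ι) (f : FreeAlgebra K (ι × ι)) :
    reflection (· > ·) qi q (creation K ι) u v f ∈ reflectionIdeal ι q qi :=
  Submodule.subset_span ⟨1, f, u, v, by rw [one_mul]⟩

/-- The spanning elements `a * ρ f` are handled by induction on the left factor `a`. Since creation
is left multiplication, an entry of `ρ` at `f` is the corresponding relation times `f`; the span is
thus a two-sided ideal. -/
theorem annihilation_mem_reflectionIdeal (h : q * qi = 1) (hN : Exchange q qi N) (b c : ι)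
    {g : FreeAlgebra K (ι × ι)} (hg : g ∈ reflectionIdeal ι q qi) :
    N b c g ∈ reflectionIdeal ι q qi := by
  have hmul : ∀ a g, g ∈ reflectionIdeal ι q qi → (∀ i j, N i j g ∈ reflectionIdeal ι q qi) →
      ∀ i j, N i j (a * g) ∈ reflectionIdeal ι q qi := by
    intro a
    induction a using FreeAlgebra.induction with
    | grade0 r =>
      intro g _ hNg i j
      rw [← Algebra.smul_def, map_smul]; exact Submodule.smul_mem _ _ (hNg i j)
    | grade1 x =>
      intro g hg hNg i j
      exact annihilation_creation_mem h hN _ (fun _ _ _ h => mul_mem_reflectionIdeal _ h) hg hNg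
        x.1 i j x.2
    | mul a b ha hb =>
      intro g hg hNg i j
      rw [mul_assoc]; exact ha _ (mul_mem_reflectionIdeal _ hg) (hb _ hg hNg) i j
    | add a b ha hb =>
      intro g hg hNg i j
      rw [add_mul, map_add]; exact Submodule.add_mem _ (ha _ hg hNg i j) (hb _ hg hNg i j)
  induction hg using Submodule.span_induction with
  | mem g hg =>
    obtain ⟨a, f, u, v, rfl⟩ := hg
    exact hmul a _ (reflection_mem u v f) (fun i j =>
      annihilation_reflection_mem h hN _ (fun u v f => reflection_mem u v f) i j u v f) b c
  | zero => simp
  | add x y _ _ hx hy => rw [map_add]; exact Submodule.add_mem _ hx hy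
  | smul c x _ hx => rw [map_smul]; exact Submodule.smul_mem _ _ hx

/-- The relations have no constant term. Thus the constant term is a functional on the quotient,
used below to detect coefficients. -/
theorem algebraMapInv_reflectionIdeal {g : FreeAlgebra K (ι × ι)}
    (hg : g ∈ reflectionIdeal ι q qi) : FreeAlgebra.algebraMapInv g = 0 := by
  let I : Submodule K (FreeAlgebra K (ι × ι)) :=
    LinearMap.ker (FreeAlgebra.algebraMapInv (R := K) (X := ι × ι)).toLinearMap
  have hC : ∀ i j w, inLast ι (creation K ι) i j w ∈ I := fun i j w =>
    inLast_apply_mem I w (fun i j => by simp [I, creation, FreeAlgebra.algebraMapInv]) i j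
  have hM : ∀ (M : Matrix (ι × ι) (ι × ι) (FockEnd K ι)) i j w,
      (inLast ι (creation K ι) * M) i j w ∈ I := by
    intro M i j w
    rw [Matrix.mul_apply, LinearMap.sum_apply]
    exact I.sum_mem fun e _ => hC _ _ _
  have hrefl : ∀ u v f, reflection (· > ·) qi q (creation K ι) u v f ∈ I := by
    intro u v f
    rw [reflection, Matrix.sub_apply, LinearMap.sub_apply]
    simp only [mul_assoc]
    refine I.sub_mem (mul_apply_mem I f (fun i j w hw => scalars_apply_mem I i j w hw)
      (fun i j => hM _ _ _ _) _ _) (hM _ _ _ _)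
  induction hg using Submodule.span_induction with
  | mem g hg =>
    obtain ⟨a, f, u, v, rfl⟩ := hg
    have := hrefl u v f
    simp only [I, LinearMap.mem_ker, AlgHom.toLinearMap_apply] at this
    rw [map_mul, this, mul_zero]
  | zero => simp
  | add x y _ _ hx hy => rw [map_add, hx, hy, add_zero]
  | smul c x _ hx => rw [map_smul, hx, smul_zero]

end FockIdeal

/-! ### The defining relations in braided form. -/

section Presentation

variable {n : ℕ}

theorem q_mul_inv : q * q⁻¹ = 1 := by
  refine mul_inv_cancel₀ ?_
  intro h
  have : qA = 0 := by
    apply IsFractionRing.injective A K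
    rw [map_zero]; exact h
  exact (LaurentPolynomial.isUnit_T (R := ℂ) 1).ne_zero this

theorem Omega_apply (u v : Fin n × Fin n) : Omega n u v = if v = u.swap then 1 else 0 := by
  obtain ⟨a, b⟩ := u
  obtain ⟨c, d⟩ := v
  simp only [Omega, Matrix.sum_apply, Matrix.kronecker_apply, Matrix.single_apply, ite_mul,
    mul_ite, mul_zero, one_mul, zero_mul]
  rw [Finset.sum_eq_single a, Finset.sum_eq_single b]
  · simp [Prod.ext_iff]
    by_cases h : b = c <;> by_cases h' : a = d <;> simp [h, h', eq_comm]
  · intro i _ hi; simp [hi]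
  · simp
  · intro i _ hi; simp [hi]
  · simp

theorem R_apply (u v : Fin n × Fin n) : R n u v
    = (if v = u then (if u.1 = u.2 then q else 1) else 0)
      + (if v = u.swap then (if u.1 < u.2 then q - q⁻¹ else 0) else 0) := by
  obtain ⟨a, b⟩ := u
  obtain ⟨c, d⟩ := v
  have hk : ∀ i j k l : Fin n,
      (Matrix.single i j (1 : K) ⊗ₖ Matrix.single k l (1 : K)) (a, b) (c, d)
        = if i = a ∧ j = c ∧ k = b ∧ l = d then 1 else 0 := by
    intro i j k l
    rw [Matrix.kronecker_apply, Matrix.single_apply, Matrix.single_apply]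
    by_cases h1 : i = a <;> by_cases h2 : j = c <;> simp [h1, h2]
  have h1 : (∑ i : Fin n, Matrix.single i i (1 : K) ⊗ₖ Matrix.single i i (1 : K)) (a, b) (c, d)
      = if a = b ∧ a = c ∧ b = d then 1 else 0 := by
    simp only [Matrix.sum_apply, hk]
    rw [Finset.sum_eq_single a (fun i _ hi => if_neg fun h => hi h.1) (by simp)]
    refine if_congr ⟨?_, ?_⟩ rfl rfl
    · rintro ⟨-, rfl, rfl, rfl⟩; simp
    · rintro ⟨rfl, rfl, rfl⟩; simp
  have h2 : (∑ i : Fin n, ∑ j ∈ Finset.univ.filter (fun j : Fin n => i ≠ j),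
        Matrix.single i i (1 : K) ⊗ₖ Matrix.single j j (1 : K)) (a, b) (c, d)
      = if a ≠ b ∧ a = c ∧ b = d then 1 else 0 := by
    simp only [Matrix.sum_apply, hk]
    simp only [Finset.sum_filter]
    rw [Finset.sum_eq_single a (fun i _ hi => Finset.sum_eq_zero fun j _ => by simp [hi])
      (by simp), Finset.sum_eq_single b (fun i _ hi => by simp [hi]) (by simp), ← ite_and]
    simp
  have h3 : (∑ i : Fin n, ∑ j ∈ Finset.univ.filter (fun j : Fin n => j < i),
        Matrix.single j i (1 : K) ⊗ₖ Matrix.single i j (1 : K)) (a, b) (c, d)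
      = if a < b ∧ b = c ∧ a = d then 1 else 0 := by
    simp only [Matrix.sum_apply, hk]
    simp only [Finset.sum_filter]
    rw [Finset.sum_eq_single b (fun i _ hi => Finset.sum_eq_zero fun j _ => by simp [hi])
      (by simp), Finset.sum_eq_single a (fun i _ hi => by simp [hi]) (by simp), ← ite_and]
    simp
  rw [R, Matrix.add_apply, Matrix.add_apply, Matrix.smul_apply, Matrix.smul_apply, h1, h2, h3]
  have e1 : ((c, d) = (a, b)) ↔ (a = c ∧ b = d) := by
    rw [Prod.mk.injEq, eq_comm, eq_comm (a := d)]
  have e2 : ((c, d) = (b, a)) ↔ (b = c ∧ a = d) := by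
    rw [Prod.mk.injEq, eq_comm, eq_comm (a := d)]
  simp only [Prod.swap_prod_mk, e1, e2, smul_eq_mul, mul_ite, mul_one, mul_zero, ite_and]
  congr 1
  · clear hk h1 h2 h3 e1 e2
    split_ifs <;> simp_all
  · clear hk h1 h2 h3 e1 e2
    split_ifs <;> simp_all

theorem Omega_mul_apply (M : Matrix (Fin n × Fin n) (Fin n × Fin n) K) (u v : Fin n × Fin n) :
    (Omega n * M) u v = M u.swap v := by
  simp [Matrix.mul_apply, Omega_apply]

theorem mul_Omega_apply (M : Matrix (Fin n × Fin n) (Fin n × Fin n) K) (u v : Fin n × Fin n) :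
    (M * Omega n) u v = M u v.swap := by
  have h : ∀ w : Fin n × Fin n, v = w.swap ↔ w = v.swap := fun w =>
    ⟨fun h => by rw [h, Prod.swap_swap], fun h => by rw [h, Prod.swap_swap]⟩
  simp [Matrix.mul_apply, Omega_apply, h]

theorem Omega_mul_Omega : Omega n * Omega n = 1 := by
  ext u v
  rw [Omega_mul_apply, Omega_apply, Prod.swap_swap, Matrix.one_apply]
  simp only [eq_comm]

theorem R_eq : R n = Omega n * brd (· < ·) q q⁻¹ := by
  ext ⟨a, b⟩ v
  rw [Omega_mul_apply, R_apply]
  simp [brd, eq_comm]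

theorem flip21_eq (M : Matrix (Fin n × Fin n) (Fin n × Fin n) K) :
    flip21 M = Omega n * M * Omega n := by
  ext u v
  rw [mul_Omega_apply, Omega_mul_apply]; rfl

theorem flip21_R_eq : flip21 (R n) = brd (· < ·) q q⁻¹ * Omega n := by
  rw [flip21_eq, R_eq, ← mul_assoc (Omega n), Omega_mul_Omega, one_mul]

theorem R_inv_eq : (R n)⁻¹ = brd (· > ·) q⁻¹ q * Omega n := by
  apply Matrix.inv_eq_left_inv
  rw [R_eq, mul_assoc, ← mul_assoc (Omega n), Omega_mul_Omega, one_mul, brd_inv_mul_brd q_mul_inv]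

theorem flip21_R_inv_eq : (flip21 (R n))⁻¹ = Omega n * brd (· > ·) q⁻¹ q := by
  apply Matrix.inv_eq_left_inv
  rw [flip21_R_eq, mul_assoc, ← mul_assoc (brd _ _ _), brd_inv_mul_brd q_mul_inv, one_mul,
    Omega_mul_Omega]

variable {B : Type*} [Ring B] [Algebra K B] (f : Free n →ₐ[K] B)

/-- The images of the `xᵢⱼ` under a homomorphism, as a matrix. -/
def genX : Matrix (Fin n) (Fin n) B := Matrix.of fun i j => f (FreeAlgebra.ι K (Gen.x i j))

/-- The images of the `∂ᵢⱼ` under a homomorphism, as a matrix. -/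
def genD : Matrix (Fin n) (Fin n) B := Matrix.of fun i j => f (FreeAlgebra.ι K (Gen.d i j))

theorem map_scal (M : Matrix (Fin n × Fin n) (Fin n × Fin n) K) :
    f.mapMatrix (scal M) = scalars B _ M := by
  ext u v; simp [scal]

theorem map_inSnd (M : Matrix (Fin n) (Fin n) (Free n)) :
    f.mapMatrix (inSnd M) = inLast (Fin n) (f.mapMatrix M) := by
  ext ⟨a, b⟩ ⟨c, d⟩
  by_cases h : a = c <;> simp [inSnd, inLast_apply, h]

theorem map_inFst (M : Matrix (Fin n) (Fin n) (Free n)) :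
    f.mapMatrix (inFst M) = scalars B _ (Omega n) * inLast (Fin n) (f.mapMatrix M)
      * scalars B _ (Omega n) := by
  have h : ∀ v w : Fin n × Fin n, v = w.swap ↔ w = v.swap := fun v w =>
    ⟨fun h => by rw [h, Prod.swap_swap], fun h => by rw [h, Prod.swap_swap]⟩
  ext ⟨a, b⟩ ⟨c, d⟩
  simp only [Matrix.mul_apply, RingHom.mapMatrix_apply, Matrix.map_apply, Omega_apply,
    apply_ite (algebraMap K B), map_one, map_zero, ite_mul, one_mul, zero_mul, mul_ite, mul_one,
    mul_zero, Finset.sum_ite_eq', Finset.mem_univ, if_true, h (c, d)]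
  by_cases h : b = d <;> simp [inFst, inLast_apply, h]

theorem Omega_scalars_cancel (Z : Matrix (Fin n × Fin n) (Fin n × Fin n) B) :
    scalars B _ (Omega n) * (scalars B _ (Omega n) * Z) = Z := by
  rw [← mul_assoc, ← map_mul, Omega_mul_Omega, map_one, one_mul]

theorem map_xx_left : f.mapMatrix (scal (flip21 (R n)) * inFst (X n) * scal (R n) * inSnd (X n))
    = scalars B _ (brd (· < ·) q q⁻¹) * inLast _ (genX f) * scalars B _ (brd (· < ·) q q⁻¹)
      * inLast _ (genX f) := by
  have h : f.mapMatrix (X n) = genX f := rfl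
  simp only [flip21_R_eq]
  simp only [map_mul, map_scal, map_inFst, map_inSnd, h, R_eq, mul_assoc,
    Omega_scalars_cancel]

theorem map_xx_right : f.mapMatrix (inSnd (X n) * scal (flip21 (R n)) * inFst (X n) * scal (R n))
    = inLast _ (genX f) * scalars B _ (brd (· < ·) q q⁻¹) * inLast _ (genX f)
      * scalars B _ (brd (· < ·) q q⁻¹) := by
  have h : f.mapMatrix (X n) = genX f := rfl
  simp only [flip21_R_eq]
  simp only [map_mul, map_scal, map_inFst, map_inSnd, h, R_eq, mul_assoc,
    Omega_scalars_cancel]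

theorem map_dd_left :
    f.mapMatrix (scal (R n)⁻¹ * inFst (D n) * scal (flip21 (R n))⁻¹ * inSnd (D n))
    = scalars B _ (brd (· > ·) q⁻¹ q) * inLast _ (genD f) * scalars B _ (brd (· > ·) q⁻¹ q)
      * inLast _ (genD f) := by
  have h : f.mapMatrix (D n) = genD f := rfl
  simp only [map_mul, map_scal, map_inFst, map_inSnd, h, R_inv_eq, flip21_R_inv_eq, mul_assoc,
    Omega_scalars_cancel]

theorem map_dd_right :
    f.mapMatrix (inSnd (D n) * scal (R n)⁻¹ * inFst (D n) * scal (flip21 (R n))⁻¹)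
    = inLast _ (genD f) * scalars B _ (brd (· > ·) q⁻¹ q) * inLast _ (genD f)
      * scalars B _ (brd (· > ·) q⁻¹ q) := by
  have h : f.mapMatrix (D n) = genD f := rfl
  simp only [map_mul, map_scal, map_inFst, map_inSnd, h, R_inv_eq, flip21_R_inv_eq, mul_assoc,
    Omega_scalars_cancel]

theorem map_dx_left :
    f.mapMatrix (inFst (D n) * scal (flip21 (R n))⁻¹ * inSnd (X n) * scal (flip21 (R n)))
    = scalars B _ (Omega n) * (inLast _ (genD f) * scalars B _ (brd (· > ·) q⁻¹ q)
      * inLast _ (genX f) * scalars B _ (brd (· < ·) q q⁻¹)) * scalars B _ (Omega n) := by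
  have h : f.mapMatrix (D n) = genD f := rfl
  have h' : f.mapMatrix (X n) = genX f := rfl
  simp only [flip21_R_inv_eq]
  simp only [map_mul, map_scal, map_inFst, map_inSnd, h, h', flip21_R_eq,
    mul_assoc, Omega_scalars_cancel]

theorem map_dx_right :
    f.mapMatrix (scal (R n) * inSnd (X n) * scal (flip21 (R n)) * inFst (D n)
        + scal ((q - q⁻¹) • (R n * Omega n)))
    = scalars B _ (Omega n) * (scalars B _ (brd (· < ·) q q⁻¹) * inLast _ (genX f)
      * scalars B _ (brd (· < ·) q q⁻¹) * inLast _ (genD f)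
      + (q - q⁻¹) • scalars B _ (brd (· < ·) q q⁻¹)) * scalars B _ (Omega n) := by
  have h : f.mapMatrix (D n) = genD f := rfl
  have h' : f.mapMatrix (X n) = genX f := rfl
  have h'' : ∀ M : Matrix (Fin n × Fin n) (Fin n × Fin n) K,
      scalars B _ ((q - q⁻¹) • M) = (q - q⁻¹) • scalars B _ M := fun M => by
    ext u v
    simp only [RingHom.mapMatrix_apply, Matrix.map_apply, Matrix.smul_apply, smul_eq_mul, map_mul,
      Algebra.smul_def (A := B)]
  simp only [flip21_R_eq]
  simp only [map_add, map_mul, map_scal, map_inFst, map_inSnd, h, h', h'', R_eq,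
    mul_assoc, Omega_scalars_cancel, mul_add, add_mul, mul_smul_comm, smul_mul_assoc]

/-- The defining relations in braided form. -/
structure BraidedRel (f : Free n →ₐ[K] B) : Prop where
  xx : scalars B _ (brd (· < ·) q q⁻¹) * inLast _ (genX f) * scalars B _ (brd (· < ·) q q⁻¹)
      * inLast _ (genX f) = inLast _ (genX f) * scalars B _ (brd (· < ·) q q⁻¹) *
      inLast _ (genX f) * scalars B _ (brd (· < ·) q q⁻¹)
  dd : scalars B _ (brd (· > ·) q⁻¹ q) * inLast _ (genD f) * scalars B _ (brd (· > ·) q⁻¹ q)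
      * inLast _ (genD f) = inLast _ (genD f) * scalars B _ (brd (· > ·) q⁻¹ q) *
      inLast _ (genD f) * scalars B _ (brd (· > ·) q⁻¹ q)
  dx : inLast _ (genX f) * scalars B _ (brd (· < ·) q q⁻¹) * inLast _ (genD f)
      = scalars B _ (brd (· > ·) q⁻¹ q) * (inLast _ (genD f) * scalars B _ (brd (· > ·) q⁻¹ q)
      * inLast _ (genX f)) * scalars B _ (brd (· < ·) q q⁻¹) + (-(q - q⁻¹)) • 1

/-- Cancel the conjugation by the flip `p`, then multiply by `b'` on the left. This solves the mixed
relation for `X b D`, the form in which it is read as an exchange relation. -/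
theorem dx_iff {M : Type*} [Ring M] [Algebra K M] {b b' p X D : M} (c : K) (hb : b * b' = 1)
    (hb' : b' * b = 1) (hp : p * p = 1) :
    p * (D * b' * X * b) * p = p * (b * X * b * D + c • b) * p ↔
      X * b * D = b' * (D * b' * X) * b + (-c) • 1 := by
  have hp' : ∀ Y Z : M, p * Y * p = p * Z * p ↔ Y = Z := fun Y Z => by
    refine ⟨fun h => ?_, fun h => by rw [h]⟩
    have := congrArg (fun w => p * w * p) h
    simpa only [mul_assoc, hp, mul_one, ← mul_assoc p p, one_mul] using this
  rw [hp']
  have h1 : b' * (b * X * b * D + c • b) = X * b * D + c • 1 := by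
    simp only [mul_add, mul_smul_comm, hb', ← mul_assoc, one_mul]
  have h2 : b' * (D * b' * X * b) = b' * (D * b' * X) * b := by simp only [mul_assoc]
  rw [← h2, neg_smul, ← sub_eq_add_neg, eq_sub_iff_add_eq, ← h1]
  refine ⟨fun h => by rw [h], fun h => ?_⟩
  have := congrArg (b * ·) h
  simpa only [← mul_assoc, hb, one_mul] using this.symm

theorem braidedRel_iff : BraidedRel f ↔ ∀ u v, Rel n u v → f u = f v := by
  have hm : ∀ (M : Matrix (Fin n × Fin n) (Fin n × Fin n) (Free n)) a b,
      f (M a b) = f.mapMatrix M a b := fun _ _ _ => rfl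
  have hdx := dx_iff (b := scalars B (Fin n × Fin n) (brd (· < ·) q q⁻¹))
    (b' := scalars B (Fin n × Fin n) (brd (· > ·) q⁻¹ q)) (p := scalars B _ (Omega n))
    (X := inLast _ (genX f)) (D := inLast _ (genD f)) (q - q⁻¹)
    (by rw [← map_mul, brd_mul_brd_inv q_mul_inv, map_one])
    (by rw [← map_mul, brd_inv_mul_brd q_mul_inv, map_one])
    (by rw [← map_mul, Omega_mul_Omega, map_one])
  constructor
  · rintro ⟨hxx, hdd, hdx'⟩ u v (⟨a, b⟩ | ⟨a, b⟩ | ⟨a, b⟩)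
    · rw [hm, hm, map_xx_left, map_xx_right, hxx]
    · rw [hm, hm, map_dd_left, map_dd_right, hdd]
    · rw [hm, hm, map_dx_left, map_dx_right, hdx.mpr hdx']
  · intro h
    refine ⟨?_, ?_, hdx.mp ?_⟩
    · rw [← map_xx_left, ← map_xx_right]; ext1 a b; exact h _ _ (Rel.xx a b)
    · rw [← map_dd_left, ← map_dd_right]; ext1 a b; exact h _ _ (Rel.dd a b)
    · rw [← map_dx_left, ← map_dx_right]; ext1 a b; exact h _ _ (Rel.dx a b)

theorem braidedRel_toD1 : BraidedRel (toD1 n) := by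
  rw [braidedRel_iff]
  intro u v h
  exact RingQuot.mkAlgHom_rel K h

end Presentation

/-! ### The Fock representation. -/

section Representation

variable {n : ℕ}

/-- The action of the free algebra by creation and (rescaled) annihilation operators. -/
def fock (N : Matrix (Fin n) (Fin n) (FockEnd K (Fin n))) : Free n →ₐ[K] FockEnd K (Fin n) :=
  FreeAlgebra.lift K fun
    -- The exchange relation for `N` has inhomogeneous term `1`, whereas the braided mixed relation
    -- has `-(q - q⁻¹)`. The relation between the `x` is homogeneous, so the rescaling does not
    -- affect it.
    | Gen.x i j => (-(q - q⁻¹)) • N i j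
    | Gen.d i j => creation K (Fin n) i j

variable {N : Matrix (Fin n) (Fin n) (FockEnd K (Fin n))}

theorem genX_fock : genX (fock N) = (-(q - q⁻¹)) • N := by
  ext1 i j; simp [genX, fock]

theorem genD_fock : genD (fock N) = creation K (Fin n) := by
  ext1 i j; simp [genD, fock]

theorem fock_mem_reflectionIdeal (hN : Exchange q q⁻¹ N) (w : Free n)
    {f : FreeAlgebra K (Fin n × Fin n)} (hf : f ∈ reflectionIdeal (Fin n) q q⁻¹) :
    fock N w f ∈ reflectionIdeal (Fin n) q q⁻¹ := by
  induction w using FreeAlgebra.induction generalizing f with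
  | grade0 r => rw [AlgHom.commutes]; exact Submodule.smul_mem _ r hf
  | grade1 g =>
    rw [fock, FreeAlgebra.lift_ι_apply]
    cases g with
    | x i j =>
      exact Submodule.smul_mem _ _ (annihilation_mem_reflectionIdeal q_mul_inv hN i j hf)
    | d i j => exact mul_mem_reflectionIdeal _ hf
  | mul a b ha hb => rw [map_mul]; exact ha (hb hf)
  | add a b ha hb => rw [map_add]; exact Submodule.add_mem _ (ha hf) (hb hf)

theorem inLast_smul {B ι : Type*} [Ring B] [Algebra K B] [Fintype ι] [DecidableEq ι] (c : K)
    (M : Matrix ι ι B) : inLast ι (c • M) = c • inLast ι M := by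
  ext ⟨a, b⟩ ⟨a', b'⟩
  by_cases h : a = a' <;> simp [inLast_apply, h]

theorem fock_rel (hN : Exchange q q⁻¹ N) (hN1 : ∀ i j, N i j 1 = 0) {u v : Free n}
    (h : Rel n u v) (f : FreeAlgebra K (Fin n × Fin n)) :
    fock N u f - fock N v f ∈ reflectionIdeal (Fin n) q q⁻¹ := by
  have hm : ∀ (M : Matrix (Fin n × Fin n) (Fin n × Fin n) (Free n)) a b,
      fock N (M a b) = (fock N).mapMatrix M a b := fun _ _ _ => rfl
  cases h with
  | xx a b =>
    have h1 := reflection_annihilation q_mul_inv hN hN1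
    rw [reflection, sub_eq_zero] at h1
    have h2 := congrArg (fun M => (-(q - q⁻¹)) • (-(q - q⁻¹)) • M) h1
    rw [hm, hm, map_xx_left, map_xx_right, genX_fock, inLast_smul]
    simp only [mul_smul_comm, smul_mul_assoc]
    rw [h2, sub_self]
    exact Submodule.zero_mem _
  | dd a b =>
    rw [hm, hm, map_dd_left, map_dd_right, genD_fock]
    exact reflection_mem a b f
  | dx a b =>
    rw [hm, hm, map_dx_left, map_dx_right]
    rw [(dx_iff (b := scalars (FockEnd K (Fin n)) (Fin n × Fin n) (brd (· < ·) q q⁻¹))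
      (b' := scalars (FockEnd K (Fin n)) (Fin n × Fin n) (brd (· > ·) q⁻¹ q))
      (p := scalars _ _ (Omega n))
      (X := inLast _ (genX (fock N))) (D := inLast _ (genD (fock N))) (q - q⁻¹)
      (by rw [← map_mul, brd_mul_brd_inv q_mul_inv, map_one])
      (by rw [← map_mul, brd_inv_mul_brd q_mul_inv, map_one])
      (by rw [← map_mul, Omega_mul_Omega, map_one])).mpr ?_, sub_self]
    · exact Submodule.zero_mem _
    · rw [genX_fock, genD_fock, inLast_smul]
      simp only [mul_smul_comm, smul_mul_assoc]
      rw [hN, smul_add]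

/-- On the free algebra the relations between the `∂` hold only modulo the reflection ideal. The
action descends to the quotient, where all relations hold, and there it factors through `𝓓₁`. -/
theorem fock_sub_mem (hN : Exchange q q⁻¹ N) (hN1 : ∀ i j, N i j 1 = 0) {u v : Free n}
    (h : toD1 n u = toD1 n v) (f : FreeAlgebra K (Fin n × Fin n)) :
    fock N u f - fock N v f ∈ reflectionIdeal (Fin n) q q⁻¹ := by
  set I := reflectionIdeal (Fin n) q q⁻¹
  let ρ : Free n →ₐ[K] Module.End K (FreeAlgebra K (Fin n × Fin n) ⧸ I) :=
    FreeAlgebra.lift K fun g => I.mapQ I (fock N (FreeAlgebra.ι K g))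
      fun f hf => fock_mem_reflectionIdeal hN _ hf
  have hρ : ∀ w f, ρ w (I.mkQ f) = I.mkQ (fock N w f) := by
    intro w
    induction w using FreeAlgebra.induction with
    | grade0 r => intro f; simp
    | grade1 g => intro f; simp [ρ]
    | mul a b ha hb => intro f; simp only [map_mul, Module.End.mul_apply, ha, hb]
    | add a b ha hb => intro f; simp only [map_add, LinearMap.add_apply, ha, hb]
  have hrel : ∀ ⦃u v⦄, Rel n u v → ρ u = ρ v := by
    intro u v huv
    refine LinearMap.ext fun z => ?_
    obtain ⟨f, rfl⟩ := I.mkQ_surjective z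
    rw [hρ, hρ, ← sub_eq_zero, ← map_sub, Submodule.mkQ_apply, Submodule.Quotient.mk_eq_zero]
    exact fock_rel hN hN1 huv f
  have h1 : ρ u = ρ v := by
    have h2 : ∀ w, RingQuot.liftAlgHom K ⟨ρ, hrel⟩ (toD1 n w) = ρ w := fun w =>
      RingQuot.liftAlgHom_mkAlgHom_apply K ρ hrel w
    rw [← h2, ← h2, h]
  have := hρ u f
  rw [h1, hρ, ← sub_eq_zero, ← map_sub, Submodule.mkQ_apply, Submodule.Quotient.mk_eq_zero] at this
  rw [← neg_sub]
  exact I.neg_mem this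

end Representation

/-! ### Specialization of the Fock operators at `q = 1`. -/

section Specialization

/-- Evaluation of Laurent polynomials at `q = 1`. -/
def evOne : A →+* ℂ := LaurentPolynomial.eval₂ (RingHom.id ℂ) 1

theorem evOne_T (m : ℤ) : evOne (LaurentPolynomial.T m) = 1 := by simp [evOne]

theorem evOne_C (c : ℂ) : evOne (LaurentPolynomial.C c) = c := by simp [evOne]

theorem q_inv_eq : q⁻¹ = algebraMap A K (LaurentPolynomial.T (-1)) := by
  rw [inv_eq_iff_eq_inv, ← mul_eq_one_iff_eq_inv₀, q, qA, ← map_mul, ← LaurentPolynomial.T_add]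
  · simp
  · intro h
    have h0 : (LaurentPolynomial.T (-1) : A) = 0 := by
      apply IsFractionRing.injective A K
      rw [h, map_zero]
    exact (LaurentPolynomial.isUnit_T (R := ℂ) (-1)).ne_zero h0

variable {n : ℕ}

/-- `Spec u v`: the element `u` has an integral form whose specialization at `q = 1` is the
commutative polynomial `v`. -/
inductive Spec : FreeAlgebra K (Fin n × Fin n) → MvPolynomial (Fin n × Fin n) ℂ → Prop
  | one : Spec 1 1
  | add {u v u' v'} : Spec u v → Spec u' v' → Spec (u + u') (v + v')
  | smul (a : A) {u v} : Spec u v → Spec (algebraMap A K a • u) (evOne a • v)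
  | creation (i j : Fin n) {u v} : Spec u v →
      Spec (creation K (Fin n) i j u) (MvPolynomial.X (i, j) * v)

namespace Spec

variable {u u' : FreeAlgebra K (Fin n × Fin n)} {v v' : MvPolynomial (Fin n × Fin n) ℂ}

theorem zero : Spec (n := n) 0 0 := by simpa using Spec.smul 0 (Spec.one (n := n))

theorem neg (h : Spec u v) : Spec (-u) (-v) := by
  have h1 : algebraMap A K (-1) • u = -u := by
    rw [map_neg, map_one]; exact neg_one_smul K u
  have h2 : evOne (-1) • v = -v := by
    rw [map_neg, map_one]; exact neg_one_smul ℂ v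
  rw [← h1, ← h2]
  exact Spec.smul (-1) h

theorem sub (h : Spec u v) (h' : Spec u' v') : Spec (u - u') (v - v') := by
  simpa only [sub_eq_add_neg] using h.add h'.neg

theorem q_smul (h : Spec u v) : Spec (q • u) v := by
  simpa [evOne_T, qA, q] using h.smul qA

theorem q_inv_smul (h : Spec u v) : Spec (q⁻¹ • u) v := by
  simpa [evOne_T, q_inv_eq] using h.smul (LaurentPolynomial.T (-1))

theorem weight (p : Prop) [Decidable p] (h : Spec u v) : Spec ((if p then q else 1) • u) v := by
  split_ifs
  · exact h.q_smul
  · simpa using h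

theorem weight_inv (p : Prop) [Decidable p] (h : Spec u v) :
    Spec ((if p then q⁻¹ else 1) • u) v := by
  split_ifs
  · exact h.q_inv_smul
  · simpa using h

theorem nu (p : Prop) [Decidable p] (h : Spec u v) :
    Spec ((if p then q - q⁻¹ else 0) • u) 0 := by
  split_ifs
  · rw [show (q - q⁻¹) • u = q • u - q⁻¹ • u by
      simp only [Algebra.smul_def, map_sub, sub_mul], ← sub_self v]
    exact h.q_smul.sub h.q_inv_smul
  · simpa using zero

theorem nu_inv (p : Prop) [Decidable p] (h : Spec u v) :
    Spec ((if p then q⁻¹ - q else 0) • u) 0 := by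
  split_ifs
  · rw [show (q⁻¹ - q) • u = q⁻¹ • u - q • u by
      simp only [Algebra.smul_def, map_sub, sub_mul], ← sub_self v]
    exact h.q_inv_smul.sub h.q_smul
  · simpa using zero

theorem sum {α : Type*} (s : Finset α) {f : α → FreeAlgebra K (Fin n × Fin n)}
    {g : α → MvPolynomial (Fin n × Fin n) ℂ} (h : ∀ e ∈ s, Spec (f e) (g e)) :
    Spec (∑ e ∈ s, f e) (∑ e ∈ s, g e) := by
  classical
  induction s using Finset.induction_on with
  | empty => simpa using zero
  | insert a s ha ih =>
    rw [Finset.sum_insert ha, Finset.sum_insert ha]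
    exact (h a (by simp)).add (ih fun e he => h e (by simp [he]))

variable {N : Matrix (Fin n) (Fin n) (FockEnd K (Fin n))}

/-- The exchange relation at `q = 1` is the Leibniz rule: weights become `1`, terms with a factor
`±(q - q⁻¹)` vanish, and the identity matrix contributes the derivative of the variable. Integrality
follows since the leading weight is `q` or `1`. -/
theorem annihilation_creation (hN : Exchange q q⁻¹ N) (hu : Spec u v)
    (hNu : ∀ b c, Spec (N b c u) (MvPolynomial.pderiv (c, b) v)) (a b c d : Fin n) :
    Spec (N b c (QDiff.creation K (Fin n) a d u))
      (MvPolynomial.pderiv (c, b) (MvPolynomial.X (a, d) * v)) := by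
  induction a using WellFoundedLT.induction generalizing b c with
  | ind a ih =>
  have key := congrArg (fun M : Matrix (Fin n × Fin n) (Fin n × Fin n) (FockEnd K (Fin n)) =>
    M (a, b) (c, d) u) hN
  simp only [Matrix.add_apply, exchange_apply, sandwich_apply, LinearMap.add_apply,
    LinearMap.smul_apply, LinearMap.sum_apply, Module.End.mul_apply] at key
  have hval : MvPolynomial.pderiv (c, b) (MvPolynomial.X (a, d) * v)
      = MvPolynomial.X (a, d) * MvPolynomial.pderiv (c, b) v
        + if (a, b) = (c, d) then v else 0 := by
    rw [Derivation.leibniz, MvPolynomial.pderiv_X, smul_eq_mul, smul_eq_mul]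
    congr 1
    have e : ((c, b) = (a, d)) ↔ ((a, b) = (c, d)) := by
      simp only [Prod.mk.injEq, eq_comm (a := c)]
    by_cases h : (a, b) = (c, d)
    · rw [if_pos h, e.mpr h, Pi.single_eq_same, mul_one]
    · rw [if_neg h, Pi.single_eq_of_ne (fun h' => h (e.mp h'.symm)), mul_zero]
  have hone : Spec ((1 : Matrix (Fin n × Fin n) (Fin n × Fin n) (FockEnd K (Fin n)))
      (a, b) (c, d) u) (if (a, b) = (c, d) then v else 0) := by
    rw [Matrix.one_apply]
    split_ifs
    · exact hu
    · exact zero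
  have hcn : ∀ x y z w, Spec (QDiff.creation K (Fin n) x y (N z w u))
      (MvPolynomial.X (x, y) * MvPolynomial.pderiv (w, z) v) :=
    fun x y z w => (hNu z w).creation x y
  have hA : ∀ (p p' : Prop) [Decidable p] [Decidable p'] (x y z w : Fin n) (s : Finset (Fin n)),
      Spec ((if p then q⁻¹ else 1) • QDiff.creation K (Fin n) x y (N z w u)
        + (if p' then q⁻¹ - q else 0) • ∑ e ∈ s, QDiff.creation K (Fin n) x e (N e w u))
        (MvPolynomial.X (x, y) * MvPolynomial.pderiv (w, z) v) := by
    intro p p' _ _ x y z w s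
    simpa using ((hcn x y z w).weight_inv p).add
      ((sum s fun e _ => hcn x e e w).nu_inv p')
  have hrhs := (((((hA (b = d) (b = d) a d b c (Finset.univ.filter (· > b))).weight_inv (a = b)).add
    ((hA (a = d) (a = d) b d a c (Finset.univ.filter (· > a))).nu_inv (b > a))).weight (c = d)).add
    ((((hA (b = c) (b = c) a c b d (Finset.univ.filter (· > b))).weight_inv (a = b)).add
    ((hA (a = c) (a = c) b c a d (Finset.univ.filter (· > a))).nu_inv (b > a))).nu (d < c))).add hone
  rw [← key, add_zero, add_zero, ← hval] at hrhs
  have hlow : Spec ((if a = c then q - q⁻¹ else 0) •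
      ∑ e with e < a, N b e (QDiff.creation K (Fin n) e d u)) 0 :=
    (sum _ fun e he => ih e (by simpa using he) b e).nu (a = c)
  have h1 := hrhs.sub hlow
  rw [add_sub_cancel_right, sub_zero] at h1
  have h2 := h1.weight_inv (a = c)
  have h3 : (if a = c then q⁻¹ else 1) * (if a = c then q else 1) = 1 := by
    split_ifs
    · rw [mul_comm, q_mul_inv]
    · simp
  rwa [smul_smul, h3, one_smul] at h2

theorem annihilation (hN : Exchange q q⁻¹ N) (hN1 : ∀ i j, N i j 1 = 0) (hu : Spec u v)
    (b c : Fin n) : Spec (N b c u) (MvPolynomial.pderiv (c, b) v) := by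
  induction hu generalizing b c with
  | one => simpa [hN1] using zero
  | add _ _ h h' => simpa using (h b c).add (h' b c)
  | smul a _ h => simpa using (h b c).smul a
  | creation i j h ih => exact annihilation_creation hN h ih i b c j

/-- `Spec` is only a relation, and uniqueness of specializations is never needed in full: the
constant term is well defined because `ℂ[q, q⁻¹]` embeds in `ℂ(q)`, and this suffices. -/
theorem const (hu : Spec u v) :
    ∃ a : A, FreeAlgebra.algebraMapInv u = algebraMap A K a ∧
      evOne a = MvPolynomial.coeff 0 v := by
  induction hu with
  | one => exact ⟨1, by simp, by simp⟩
  | add _ _ h h' =>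
    obtain ⟨a, ha, ha'⟩ := h
    obtain ⟨b, hb, hb'⟩ := h'
    exact ⟨a + b, by simp [ha, hb], by simp [ha', hb']⟩
  | smul c _ h =>
    obtain ⟨a, ha, ha'⟩ := h
    exact ⟨c * a, by rw [map_smul, ha, map_mul, smul_eq_mul], by simp [ha']⟩
  | creation i j h =>
    exact ⟨0, by simp [QDiff.creation, FreeAlgebra.algebraMapInv], by
      rw [map_zero, ← MvPolynomial.constantCoeff_eq, map_mul, MvPolynomial.constantCoeff_X, zero_mul]⟩

end Spec

end Specialization

/-! ### Divisibility by `q - 1` in the Laurent polynomials. -/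

section EvaluationAtOne

theorem sub_one_dvd_T_sub_one (m : ℤ) : qA - 1 ∣ LaurentPolynomial.T m - 1 := by
  have hnat : ∀ k : ℕ, qA - 1 ∣ LaurentPolynomial.T (k : ℤ) - 1 := fun k => by
    have h := sub_dvd_pow_sub_pow qA 1 k
    rwa [one_pow, qA, LaurentPolynomial.T_pow, mul_one] at h
  obtain ⟨k, rfl | rfl⟩ := m.eq_nat_or_neg
  · exact hnat k
  · have h : (LaurentPolynomial.T (-(k : ℤ)) - 1 : A)
        = -LaurentPolynomial.T (-(k : ℤ)) * (LaurentPolynomial.T (k : ℤ) - 1) := by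
      rw [mul_sub, neg_mul, ← LaurentPolynomial.T_add]
      simp
      ring
    rw [h]
    exact (hnat k).mul_left _

theorem sub_one_dvd_sub_C_evOne (a : A) : qA - 1 ∣ a - LaurentPolynomial.C (evOne a) := by
  induction a using LaurentPolynomial.induction_on' with
  | add a b ha hb =>
    rw [map_add, map_add, add_sub_add_comm]
    exact dvd_add ha hb
  | C_mul_T m c =>
    rw [map_mul, evOne_C, evOne_T, mul_one, ← mul_sub_one]
    exact (sub_one_dvd_T_sub_one m).mul_left _

theorem sub_one_dvd_of_evOne_eq_zero {a : A} (h : evOne a = 0) : qA - 1 ∣ a := by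
  simpa [h] using sub_one_dvd_sub_C_evOne a

theorem evOne_sub_one : evOne (qA - 1) = 0 := by
  rw [map_sub, qA, evOne_T, map_one, sub_self]

/-- Evaluate at `q = 2`, where distinct powers are distinct. -/
theorem T_ne_T {a b : ℤ} (h : a ≠ b) :
    (LaurentPolynomial.T a : A) ≠ LaurentPolynomial.T b := by
  intro h1
  have h2 := congrArg (LaurentPolynomial.eval₂ (RingHom.id ℂ) (Units.mk0 2 two_ne_zero)) h1
  simp only [LaurentPolynomial.eval₂_T, Units.val_zpow_eq_zpow_val, Units.val_mk0] at h2
  refine h (zpow_right_injective₀ (a := (2 : ℝ)) (by norm_num) (by norm_num) ?_)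
  show (2 : ℝ) ^ a = 2 ^ b
  rw [← Complex.ofReal_inj]
  push_cast
  exact h2

theorem qA_sub_one_ne_zero : qA - 1 ≠ 0 := by
  rw [← LaurentPolynomial.T_zero]
  exact sub_ne_zero.mpr (T_ne_T one_ne_zero)

instance : IsNoetherianRing A :=
  IsLocalization.isNoetherianRing (Submonoid.powers (Polynomial.X : Polynomial ℂ)) A inferInstance

/-- Krull's intersection theorem for the proper ideal `(q - 1)` in a Noetherian domain. -/
theorem eq_zero_of_forall_sub_one_pow_dvd {a : A} (h : ∀ m : ℕ, (qA - 1) ^ m ∣ a) : a = 0 := by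
  have htop : Ideal.span {qA - 1} ≠ ⊤ := by
    intro h1
    obtain ⟨b, hb⟩ := Ideal.mem_span_singleton.mp ((Ideal.eq_top_iff_one _).mp h1)
    have := congrArg evOne hb
    rw [map_mul, evOne_sub_one, zero_mul, map_one] at this
    exact one_ne_zero this
  rw [← Ideal.mem_bot, ← Ideal.iInf_pow_eq_bot_of_isDomain _ htop, Ideal.mem_iInf]
  intro m
  rw [Ideal.span_singleton_pow, Ideal.mem_span_singleton]
  exact h m

/-- If a space of families of Laurent polynomials vanishes at `q = 1` and is stable under division
by `q - 1`, then it vanishes. -/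
theorem eq_zero_of_evOne_eq_zero {α : Type*} (S : (α →₀ A) → Prop)
    (hS : ∀ c, S c → ∀ s, evOne (c s) = 0) (hdiv : ∀ c, S ((qA - 1) • c) → S c)
    {c : α →₀ A} (hc : S c) : c = 0 := by
  have step : ∀ c, S c → ∃ c', S c' ∧ c = (qA - 1) • c' := by
    intro c hc
    choose g hg using fun s => sub_one_dvd_of_evOne_eq_zero (hS c hc s)
    have hc' : c = (qA - 1) • Finsupp.onFinset c.support g fun s hs => by
        rw [Finsupp.mem_support_iff, hg s]
        exact mul_ne_zero qA_sub_one_ne_zero hs := by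
      ext1 s
      exact hg s
    exact ⟨_, hdiv _ (hc' ▸ hc), hc'⟩
  have hpow : ∀ m : ℕ, ∃ c', S c' ∧ c = (qA - 1) ^ m • c' := by
    intro m
    induction m with
    | zero => exact ⟨c, hc, by simp⟩
    | succ m ih =>
      obtain ⟨c', h1, h2⟩ := ih
      obtain ⟨c'', h3, h4⟩ := step c' h1
      exact ⟨c'', h3, by rw [h2, h4, smul_smul, pow_succ]⟩
  ext1 s
  refine eq_zero_of_forall_sub_one_pow_dvd fun m => ?_
  obtain ⟨c', -, h⟩ := hpow m
  exact ⟨c' s, by rw [h]; rfl⟩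

end EvaluationAtOne

/-! ### Pairing of monomials with iterated partial derivatives. -/

section Derivatives

open MvPolynomial

variable {σ : Type*}

/-- The exponent of the monomial whose variables are listed. -/
def expo (l : List σ) : σ →₀ ℕ := by
  classical exact Multiset.toFinsupp (l : Multiset σ)

theorem expo_nil : expo ([] : List σ) = 0 := by simp [expo]

theorem expo_cons (i : σ) (l : List σ) : expo (i :: l) = Finsupp.single i 1 + expo l := by
  classical
  rw [expo, ← Multiset.cons_coe, ← Multiset.singleton_add, map_add, Multiset.toFinsupp_singleton]
  rfl

theorem expo_eq_iff {l l' : List σ} : expo l = expo l' ↔ l.Perm l' := by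
  classical
  rw [expo, expo, EmbeddingLike.apply_eq_iff_eq, Multiset.coe_eq_coe]

theorem degree_expo (l : List σ) : (expo l).degree = l.length := by
  induction l with
  | nil => simp [expo_nil]
  | cons i l ih => rw [expo_cons, map_add, ih, Finsupp.degree_single, List.length_cons, add_comm]

theorem prod_map_X (l : List σ) :
    (l.map fun i => (MvPolynomial.X i : MvPolynomial σ ℂ)).prod = monomial (expo l) 1 := by
  induction l with
  | nil => simp [expo_nil]
  | cons i l ih =>
    rw [List.map_cons, List.prod_cons, ih, expo_cons, MvPolynomial.X, monomial_mul, one_mul]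

/-- The composite of the partial derivatives along a list of variables. -/
def pderivs (l : List σ) : Module.End ℂ (MvPolynomial σ ℂ) :=
  (l.map fun i => ((pderiv i : Derivation ℂ _ _) : Module.End ℂ (MvPolynomial σ ℂ))).prod

theorem coeff_pderivs (l : List σ) (m : σ →₀ ℕ) :
    ∃ k : ℂ, k ≠ 0 ∧ ∀ v, coeff m (pderivs l v) = k * coeff (m + expo l) v := by
  induction l generalizing m with
  | nil => exact ⟨1, one_ne_zero, fun v => by simp [pderivs, expo_nil]⟩
  | cons i l ih =>
    obtain ⟨k, hk, h⟩ := ih (m + Finsupp.single i 1)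
    refine ⟨k * (m i + 1), mul_ne_zero hk (Nat.cast_add_one_ne_zero _), fun v => ?_⟩
    have h1 : pderivs (i :: l) v = pderiv i (pderivs l v) := by simp [pderivs]
    rw [h1, coeff_pderiv, h, expo_cons, add_assoc]
    ring

/-- At least as many derivatives are taken along `x` as there are variables in `x'`, so the inner
factor is zero or a constant, nonzero exactly when the two multisets agree. The outer derivatives
then test the monomial `d` in the same way. -/
theorem coeff_pderivs_mul_pderivs_ne_zero_iff {σ τ : Type*} (f : τ → σ)
    (hf : Function.Injective f) {d d' x x' : List τ} (h : x'.length ≤ x.length) (g : τ → σ)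
    (hg : Function.Injective g) :
    coeff 0 (pderivs (d'.map g) (((d.map g).map fun i => (MvPolynomial.X i : MvPolynomial σ ℂ)).prod *
      pderivs (x.map f) (((x'.map f).map fun i => (MvPolynomial.X i : MvPolynomial σ ℂ)).prod))) ≠ 0
      ↔ d.Perm d' ∧ x.Perm x' := by
  classical
  have hperm : ∀ (f : τ → σ) (_ : Function.Injective f) (l l' : List τ),
      expo (l.map f) = expo (l'.map f) ↔ l.Perm l' := fun f hf l l' => by
    rw [expo_eq_iff, ← Multiset.coe_eq_coe, ← Multiset.coe_eq_coe, ← Multiset.map_coe,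
      ← Multiset.map_coe, (Multiset.map_injective hf).eq_iff]
  rw [← hperm g hg, ← hperm f hf]
  obtain ⟨k, hk, hk'⟩ := coeff_pderivs (d'.map g) 0
  rw [hk', prod_map_X, prod_map_X, zero_add, mul_ne_zero_iff, and_iff_right hk,
    coeff_monomial_mul']
  obtain ⟨k', hk0, hk1⟩ := coeff_pderivs (x.map f) (expo (d'.map g) - expo (d.map g))
  rw [hk1, one_mul, coeff_monomial]
  constructor
  · intro h1
    have h2 : expo (d.map g) ≤ expo (d'.map g) := by
      by_contra h2; simp [h2] at h1
    have h3 : expo (x'.map f) = expo (d'.map g) - expo (d.map g) + expo (x.map f) := by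
      by_contra h3; simp [h3] at h1
    have h4 := congrArg Finsupp.degree h3
    simp only [map_add, degree_expo, List.length_map] at h4
    have h5 : (expo (d'.map g) - expo (d.map g)).degree = 0 := by omega
    rw [Finsupp.degree_eq_zero_iff] at h5
    exact ⟨le_antisymm h2 (tsub_eq_zero_iff_le.mp h5), by rw [h3, h5, zero_add]⟩
  · rintro ⟨h1, h2⟩
    simp [h1, h2, hk0]

end Derivatives

/-! ### Linear independence of the standard monomials. -/

section Independence

variable {n : ℕ}

/-- The letters of a lexicographically ordered pair, in this order. -/
def letter (p : Fin n ×ₗ Fin n) : Fin n × Fin n := ofLex p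

/-- The letters of a lexicographically ordered pair, exchanged. -/
def swapLetter (p : Fin n ×ₗ Fin n) : Fin n × Fin n := (ofLex p).swap

theorem letter_injective : Function.Injective (letter (n := n)) := ofLex.injective

theorem swapLetter_injective : Function.Injective (swapLetter (n := n)) :=
  Prod.swap_injective.comp ofLex.injective

/-- The product of the creation operators along a word. -/
def creationWord (l : List (Fin n × Fin n)) : FockEnd K (Fin n) :=
  (l.map fun p => creation K (Fin n) p.1 p.2).prod

/-- The product of the annihilation operators along a word. -/
def annihilationWord (N : Matrix (Fin n) (Fin n) (FockEnd K (Fin n)))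
    (l : List (Fin n × Fin n)) : FockEnd K (Fin n) :=
  (l.map fun p => N p.2 p.1).prod

/-- The word whose image in the algebra is a standard monomial. -/
def stdWord (s : StdIndex n) : Free n :=
  (s.ds.map fun p => FreeAlgebra.ι K (Gen.d (ofLex p).1 (ofLex p).2)).prod *
    (s.xs.map fun p => FreeAlgebra.ι K (Gen.x (ofLex p).1 (ofLex p).2)).prod

theorem toD1_stdWord (s : StdIndex n) : toD1 n (stdWord s) = stdMonomial s := by
  simp only [stdWord, stdMonomial, map_mul, map_list_prod, List.map_map]
  rfl

theorem StdIndex.eq_of_perm {s t : StdIndex n} (hd : s.ds.Perm t.ds) (hx : s.xs.Perm t.xs) :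
    s = t := by
  obtain ⟨ds, xs, h1, h2⟩ := s
  obtain ⟨ds', xs', h1', h2'⟩ := t
  have e1 : ds = ds' := hd.eq_of_pairwise (fun _ _ _ _ h h' => le_antisymm h' h) h1 h1'
  have e2 : xs = xs' := hx.eq_of_pairwise (fun _ _ _ _ h h' => le_antisymm h h') h2 h2'
  subst e1 e2
  rfl

variable {N : Matrix (Fin n) (Fin n) (FockEnd K (Fin n))}

theorem fock_stdWord (s : StdIndex n) :
    fock N (stdWord s) = (-(q - q⁻¹)) ^ s.xs.length •
      (creationWord (s.ds.map letter) * annihilationWord N (s.xs.map swapLetter)) := by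
  have hx : ∀ l : List (Fin n ×ₗ Fin n),
      (l.map (fun p => fock N (FreeAlgebra.ι K (Gen.x (ofLex p).1 (ofLex p).2)))).prod
        = (-(q - q⁻¹)) ^ l.length • annihilationWord N (l.map swapLetter) := by
    intro l
    induction l with
    | nil => simp [annihilationWord]
    | cons p l ih =>
      rw [List.map_cons, List.prod_cons, ih, fock, FreeAlgebra.lift_ι_apply, List.length_cons,
        smul_mul_smul_comm, ← pow_succ']
      rfl
  have hd : (s.ds.map (fun p => fock N (FreeAlgebra.ι K (Gen.d (ofLex p).1 (ofLex p).2)))).prod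
      = creationWord (s.ds.map letter) := by
    rw [creationWord, List.map_map]
    simp only [fock, FreeAlgebra.lift_ι_apply]
    rfl
  rw [stdWord, map_mul, map_list_prod, map_list_prod, List.map_map, List.map_map]
  have hx' := hx s.xs
  simp only [Function.comp_def]
  rw [hd, hx', mul_smul_comm]

theorem Spec.creationWord {u : FreeAlgebra K (Fin n × Fin n)}
    {v : MvPolynomial (Fin n × Fin n) ℂ} (h : Spec u v) (l : List (Fin n × Fin n)) :
    Spec (creationWord l u) ((l.map fun i => (MvPolynomial.X i : MvPolynomial _ ℂ)).prod * v) := by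
  induction l with
  | nil => simpa [QDiff.creationWord] using h
  | cons p l ih =>
    have := ih.creation p.1 p.2
    rwa [← mul_assoc] at this

theorem Spec.annihilationWord (hN : Exchange q q⁻¹ N) (hN1 : ∀ i j, N i j 1 = 0)
    {u : FreeAlgebra K (Fin n × Fin n)} {v : MvPolynomial (Fin n × Fin n) ℂ} (h : Spec u v)
    (l : List (Fin n × Fin n)) : Spec (annihilationWord N l u) (pderivs l v) := by
  induction l with
  | nil => simpa [QDiff.annihilationWord, pderivs] using h
  | cons p l ih => exact Spec.annihilation hN hN1 ih p.2 p.1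

theorem annihilationWord_mem (hN : Exchange q q⁻¹ N) (l : List (Fin n × Fin n))
    {g : FreeAlgebra K (Fin n × Fin n)} (hg : g ∈ reflectionIdeal (Fin n) q q⁻¹) :
    annihilationWord N l g ∈ reflectionIdeal (Fin n) q q⁻¹ := by
  induction l with
  | nil => exact hg
  | cons p l ih => exact annihilation_mem_reflectionIdeal q_mul_inv hN p.2 p.1 ih

/-- The families of coefficients of linear relations between the rescaled standard monomials on
the Fock space. -/
def FockRelation (N : Matrix (Fin n) (Fin n) (FockEnd K (Fin n))) (c : StdIndex n →₀ A) : Prop :=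
  ∀ f, c.sum (fun s a => algebraMap A K a •
    (creationWord (s.ds.map letter) * annihilationWord N (s.xs.map swapLetter)) f)
      ∈ reflectionIdeal (Fin n) q q⁻¹

/-- To isolate the coefficient of `s`, apply the relation to the creation word of `s.xs`, then
annihilate along `s.ds` and take the constant term. At `q = 1` monomials with at least as many `x`
as `s` contribute only if equal to `s`; those with fewer have coefficients vanishing at `q = 1` by
induction. -/
theorem FockRelation.evOne_eq_zero (hN : Exchange q q⁻¹ N) (hN1 : ∀ i j, N i j 1 = 0)
    {c : StdIndex n →₀ A} (hc : FockRelation N c) (s : StdIndex n) : evOne (c s) = 0 := by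
  induction hm : s.xs.length using Nat.strong_induction_on generalizing s with
  | _ m ih =>
  subst hm
  set v0 := (((s.xs.map swapLetter).map fun i =>
    (MvPolynomial.X i : MvPolynomial (Fin n × Fin n) ℂ)).prod * 1)
  have hspec : ∀ t : StdIndex n, _ := fun t =>
    ((((Spec.one (n := n)).creationWord (s.xs.map swapLetter)).annihilationWord hN hN1
      (t.xs.map swapLetter)).creationWord (t.ds.map letter)).annihilationWord hN hN1
        (s.ds.map letter)
  choose a ha ha' using fun t => (hspec t).const
  have h1 := algebraMapInv_reflectionIdeal (annihilationWord_mem hN (s.ds.map letter)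
    (hc (creationWord (s.xs.map swapLetter) 1)))
  have h2 : c.sum (fun t b => b * a t) = 0 := by
    apply IsFractionRing.injective A K
    rw [map_zero, ← h1, Finsupp.sum, Finsupp.sum, map_sum, map_sum, map_sum]
    refine Finset.sum_congr rfl fun t _ => ?_
    rw [map_mul, ← ha, map_smul, map_smul, smul_eq_mul]
    rfl
  have h3 := congrArg evOne h2
  rw [Finsupp.sum, map_sum, map_zero, Finset.sum_eq_single s] at h3
  · rw [map_mul, mul_eq_zero] at h3
    refine h3.resolve_right ?_
    rw [ha', mul_one]
    exact (coeff_pderivs_mul_pderivs_ne_zero_iff _ swapLetter_injective le_rfl _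
      letter_injective).mpr ⟨List.Perm.refl _, List.Perm.refl _⟩
  · intro t _ hts
    rw [map_mul]
    by_cases hlt : t.xs.length < s.xs.length
    · rw [ih _ hlt t rfl, zero_mul]
    · rw [ha', mul_one]
      refine mul_eq_zero_of_right _ (not_not.mp fun h => hts ?_)
      obtain ⟨p1, p2⟩ := (coeff_pderivs_mul_pderivs_ne_zero_iff _ swapLetter_injective
        (not_lt.mp hlt) _ letter_injective).mp h
      exact StdIndex.eq_of_perm p1 p2
  · intro hs
    rw [Finsupp.notMem_support_iff.mp hs, zero_mul, map_zero]

/-- The reflection ideal is a subspace over `ℂ(q)`, hence relations may be divided by `q - 1`. -/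
theorem FockRelation.eq_zero (hN : Exchange q q⁻¹ N) (hN1 : ∀ i j, N i j 1 = 0)
    {c : StdIndex n →₀ A} (hc : FockRelation N c) : c = 0 := by
  refine eq_zero_of_evOne_eq_zero (FockRelation N) (fun c hc s => hc.evOne_eq_zero hN hN1 s)
    (fun c hc f => ?_) hc
  have h := hc f
  rw [Finsupp.sum_smul_index (by simp)] at h
  simp only [map_mul, mul_smul] at h
  rw [Finsupp.sum, ← Finset.smul_sum] at h
  have h0 : algebraMap A K (qA - 1) ≠ 0 := fun h0 =>
    qA_sub_one_ne_zero (IsFractionRing.injective A K (by rw [h0, map_zero]))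
  have h1 := Submodule.smul_mem _ (algebraMap A K (qA - 1))⁻¹ h
  rwa [smul_smul, inv_mul_cancel₀ h0, one_smul] at h1

theorem linearIndependent_of_sum_smul {S B α : Type*} [CommRing S] [Ring B] [Algebra S B]
    {v : α → B} (h : ∀ c : α →₀ S, (c.sum fun s a => a • v s) = 0 → c = 0) :
    LinearIndependent S v :=
  linearIndependent_iff.mpr h

/-- The standard monomials are linearly independent over the Laurent polynomials. -/
theorem linearIndependent_stdMonomial : LinearIndependent A (stdMonomial (n := n)) := by
  obtain ⟨N, hN1, hN⟩ := exists_annihilation (ι := Fin n) q_mul_inv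
  refine linearIndependent_of_sum_smul fun c hc => ?_
  have hν : -(qA - LaurentPolynomial.T (-1)) ≠ 0 :=
    neg_ne_zero.mpr (sub_ne_zero.mpr (T_ne_T (by decide)))
  -- A standard monomial acts with one factor `-(q - q⁻¹)` for each `x`. These factors vanish at `q
  -- = 1`, so they are absorbed into the coefficients; being nonzero, they can be removed at the
  -- end.
  let c' : StdIndex n →₀ A := Finsupp.onFinset c.support
    (fun s => c s * (-(qA - LaurentPolynomial.T (-1))) ^ s.xs.length) fun s hs => by
      rw [Finsupp.mem_support_iff]
      exact left_ne_zero_of_mul hs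
  have h0 : FockRelation N c' := by
    intro f
    have h1 : toD1 n (c.sum fun s a => algebraMap A K a • stdWord s) = toD1 n 0 := by
      rw [map_zero, ← hc, Finsupp.sum, Finsupp.sum, map_sum]
      refine Finset.sum_congr rfl fun s _ => ?_
      rw [map_smul, toD1_stdWord, algebraMap_smul]
    have h2 := fock_sub_mem hN hN1 h1 f
    rw [map_zero, LinearMap.zero_apply, sub_zero, Finsupp.sum, map_sum, LinearMap.sum_apply] at h2
    rw [Finsupp.onFinset_sum _ (by simp)]
    convert h2 using 2 with s
    rw [map_smul, fock_stdWord, map_mul, map_pow, map_neg, map_sub, ← q_inv_eq, mul_smul]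
    rfl
  have h1 := h0.eq_zero hN hN1
  ext1 s
  have h2 : c s * (-(qA - LaurentPolynomial.T (-1))) ^ s.xs.length = 0 := DFunLike.congr_fun h1 s
  exact (mul_eq_zero.mp h2).resolve_right (pow_ne_zero _ hν)

end Independence

/-! ### Sorting words by the reflection equation. -/

section Straightening

variable {S B : Type*} [CommRing S] [Ring B] [Algebra S B]

/-- If every strict descent of two letters can be rewritten with a smaller first letter, then every
word is a combination of weakly increasing words. -/
theorem word_mem_span_sorted {Λ : Type*} [LinearOrder Λ] [WellFoundedLT Λ] (y : Λ → B)
    (hy : ∀ l m, m < l → y l * y m ∈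
      Submodule.span S {p | ∃ l' m', l' < l ∧ p = y l' * y m'}) (w : List Λ) :
    (w.map y).prod ∈ Submodule.span S
      {p | ∃ w' : List Λ, w'.Pairwise (· ≤ ·) ∧ w'.length = w.length ∧ p = (w'.map y).prod} := by
  induction hk : w.length generalizing w with
  | zero =>
    obtain rfl := List.eq_nil_of_length_eq_zero hk
    exact Submodule.subset_span ⟨[], List.Pairwise.nil, rfl, rfl⟩
  | succ k ih =>
    obtain ⟨l, w, rfl⟩ := List.exists_cons_of_length_eq_add_one hk
    rw [List.length_cons, Nat.succ_inj] at hk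
    -- Sort the tail by induction on the length. If the first letter still exceeds the next one,
    -- rewriting lowers it; the new second letter is arbitrary, but the new tail has the same length
    -- and the inner induction applies.
    induction l using WellFoundedLT.induction generalizing w with
    | ind l ihl =>
    rw [List.map_cons, List.prod_cons]
    have h1 := Submodule.mem_map_of_mem (f := LinearMap.mulLeft S (y l)) (ih w hk)
    rw [Submodule.map_span] at h1
    refine Submodule.span_le.mpr ?_ h1
    rintro _ ⟨_, ⟨w', hw', hl', rfl⟩, rfl⟩
    rw [LinearMap.mulLeft_apply]
    rcases w' with _ | ⟨m, w''⟩
    · exact Submodule.subset_span ⟨[l], List.pairwise_singleton _ _, congrArg Nat.succ hl', by simp⟩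
    · rcases le_or_gt l m with hlm | hml
      · refine Submodule.subset_span ⟨l :: m :: w'', List.pairwise_cons.mpr ⟨?_, hw'⟩,
          by simpa using hl', by simp⟩
        intro z hz
        rcases List.mem_cons.mp hz with rfl | hz
        · exact hlm
        · exact hlm.trans ((List.pairwise_cons.mp hw').1 z hz)
      · rw [List.map_cons, List.prod_cons, ← mul_assoc]
        have h2 := Submodule.mem_map_of_mem (f := LinearMap.mulRight S (w''.map y).prod)
          (hy l m hml)
        rw [Submodule.map_span] at h2
        refine Submodule.span_le.mpr ?_ h2
        rintro _ ⟨_, ⟨l', m', hll, rfl⟩, rfl⟩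
        rw [LinearMap.mulRight_apply]
        have h3 := ihl l' hll (m' :: w'') (by simpa using hl')
        simpa [mul_assoc] using h3

variable {ι : Type*} [Fintype ι] [DecidableEq ι] (r : ι → ι → Prop) [DecidableRel r]
  [IsStrictTotalOrder ι r] {q qi : S}

/-- The reflection equation straightens descents of two letters. -/
theorem reflection_straighten (h : q * qi = 1) {Z : Matrix ι ι B}
    (hZ : scalars B _ (brd r q qi) * inLast ι Z * scalars B _ (brd r q qi) * inLast ι Z
      = inLast ι Z * scalars B _ (brd r q qi) * inLast ι Z * scalars B _ (brd r q qi))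
    (a b c d : ι) (hlt : Prod.Lex r r (a, d) (b, c)) :
    Z b c * Z a d ∈ Submodule.span S
      {p | ∃ l m : ι × ι, Prod.Lex r r l (b, c) ∧ p = Z l.1 l.2 * Z m.1 m.2} := by
  have hirr : ∀ a, ¬ r a a := irrefl_of r
  set P := inLast ι Z * scalars B _ (brd r q qi) * inLast ι Z with hP
  have key : ∀ a b c d, (if a = b then q else 1) • P (b, a) (c, d)
      + (if r b a then q - qi else 0) • P (a, b) (c, d)
      = (if c = d then q else 1) • P (a, b) (d, c)
      + (if r d c then q - qi else 0) • P (a, b) (c, d) := by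
    intro a b c d
    rw [← brd_mul_apply, ← mul_brd_apply, hP, ← hZ]
    simp only [mul_assoc]
  set V := Submodule.span S
    {p | ∃ l m : ι × ι, Prod.Lex r r l (b, c) ∧ p = Z l.1 l.2 * Z m.1 m.2}
  have hV : ∀ x y z w, Prod.Lex r r (x, y) (b, c) → Z x y * Z z w ∈ V := fun x y z w hl =>
    Submodule.subset_span ⟨(x, y), (z, w), hl, rfl⟩
  have hunit : ∀ (p : Prop) [Decidable p] (y : B), (if p then q else 1) • y ∈ V → y ∈ V := by
    intro p _ y hy
    split_ifs at hy
    · have := V.smul_mem qi hy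
      rwa [smul_smul, mul_comm, h, one_smul] at this
    · simpa using hy
  have hlead : (∀ e, r e a → a = c → Z b e * Z e d ∈ V) → P (a, b) (c, d) ∈ V →
      Z b c * Z a d ∈ V := by
    intro h1 h2
    rw [hP, sandwich_apply] at h2
    refine hunit (a = c) _ ((Submodule.add_mem_iff_left V ?_).mp h2)
    split_ifs with hac
    · exact V.smul_mem _ (V.sum_mem fun e he => h1 e (by simpa using he) hac)
    · rw [zero_smul]; exact V.zero_mem
  -- For distinct rows the equation expresses `P (a, b)` through `P (b, a)`, whose products all
  -- begin with an entry of the smaller row `a`. For equal rows it gives `P (a, a) (c, d) = q • P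
  -- (a, a) (d, c)`, whose products begin with a smaller column.
  rcases (Prod.lex_def.mp hlt) with hab | ⟨hab, hdc⟩
  · replace hab : r a b := hab
    have hne : a ≠ b := fun h => hirr a (by rwa [← h] at hab)
    have hba : ¬ r b a := fun h' => asymm_of r hab h'
    have hPV : ∀ c d, P (b, a) (c, d) ∈ V := by
      intro c d
      rw [hP, sandwich_apply]
      exact V.add_mem (V.smul_mem _ (hV _ _ _ _ (Prod.Lex.left _ _ hab)))
        (V.smul_mem _ (V.sum_mem fun e _ => hV _ _ _ _ (Prod.Lex.left _ _ hab)))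
    refine hlead (fun e he hac => hV _ _ _ _ (Prod.Lex.right _ (hac ▸ he))) ?_
    refine hunit (d = c) _ ?_
    have h1 := key a b d c
    rw [if_neg hne, if_neg hba, one_smul, zero_smul, add_zero] at h1
    rw [← Submodule.add_mem_iff_left V (y := (if r c d then q - qi else 0) • P (a, b) (d, c)),
      ← h1]
    · exact hPV d c
    · split_ifs with hcd
      · refine V.smul_mem _ ?_
        have h2 := key a b c d
        have hcd' : c ≠ d := fun h => hirr c (by rwa [← h] at hcd)
        rw [if_neg hne, if_neg hba, if_neg hcd', if_neg (fun h' => asymm_of r hcd h'), one_smul,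
          zero_smul, add_zero, add_zero, one_smul] at h2
        rw [← h2]
        exact hPV c d
      · rw [zero_smul]; exact V.zero_mem
  · replace hab : a = b := hab
    replace hdc : r d c := hdc
    subst hab
    have hcd : c ≠ d := fun h => hirr c (by rwa [← h] at hdc)
    refine hlead (fun e he hac => hV _ _ _ _ (Prod.Lex.right _ (hac ▸ he))) ?_
    have h1 := key a a c d
    rw [if_pos rfl, if_neg (hirr a), if_neg hcd, if_pos hdc, zero_smul, add_zero, one_smul,
      sub_smul] at h1
    have h2 : qi • P (a, a) (c, d) = P (a, a) (d, c) := by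
      rw [← add_right_cancel_iff (a := q • P (a, a) (c, d) - qi • P (a, a) (c, d)), ← h1]
      abel
    have h3 : P (a, a) (d, c) ∈ V := by
      rw [hP, sandwich_apply]
      refine V.add_mem (V.smul_mem _ (hV _ _ _ _ (Prod.Lex.right _ hdc))) ?_
      split_ifs with had
      · refine V.smul_mem _ (V.sum_mem fun e he => hV _ _ _ _ (Prod.Lex.right _ ?_))
        have he' : r e a := by simpa using he
        exact trans_of r (had ▸ he') hdc
      · rw [zero_smul]; exact V.zero_mem
    have h4 := V.smul_mem q h3
    rwa [← h2, smul_smul, h, one_smul] at h4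

end Straightening

/-! ### Moving the `x` to the right of the `∂`. -/

section Exchange

variable {S B : Type*} [CommRing S] [Ring B] [Algebra S B] {ι : Type*} [Fintype ι] [LinearOrder ι]
  {q qi : S}

/-- The exchange relation moves the entries of `N` to the right of those of `C`. -/
theorem mul_mem_of_exchange (h : q * qi = 1) {C N : Matrix ι ι B} (z : S)
    (hCN : inLast ι N * scalars B _ (brd (· < ·) q qi) * inLast ι C
      = scalars B _ (brd (· > ·) qi q) * (inLast ι C * scalars B _ (brd (· > ·) qi q) *
        inLast ι N) * scalars B _ (brd (· < ·) q qi) + z • 1) (a b c d : ι) :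
    N b c * C a d ∈ Submodule.span S
      (insert 1 {p | ∃ l m : ι × ι, p = C l.1 l.2 * N m.1 m.2}) := by
  set V := Submodule.span S (insert 1 {p | ∃ l m : ι × ι, p = C l.1 l.2 * N m.1 m.2})
  have hV : ∀ x y z w, C x y * N z w ∈ V := fun x y z w =>
    Submodule.subset_span (Or.inr ⟨(x, y), (z, w), rfl⟩)
  induction a using WellFoundedLT.induction generalizing b c d with
  | ind a ih =>
  have key := congrArg (fun M : Matrix (ι × ι) (ι × ι) B => M (a, b) (c, d)) hCN
  simp only [Matrix.add_apply, exchange_apply, sandwich_apply] at key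
  have hrhs : (if a = c then q else 1) • (N b c * C a d)
      + (if a = c then q - qi else 0) • ∑ e with e < a, N b e * C e d ∈ V := by
    rw [key]
    refine V.add_mem ?_ ?_
    · refine V.add_mem (V.smul_mem _ (V.add_mem (V.smul_mem _ (V.add_mem ?_ ?_))
        (V.smul_mem _ (V.add_mem ?_ ?_)))) (V.smul_mem _ (V.add_mem (V.smul_mem _
        (V.add_mem ?_ ?_)) (V.smul_mem _ (V.add_mem ?_ ?_))))
      all_goals first
        | exact V.smul_mem _ (hV _ _ _ _)
        | exact V.smul_mem _ (V.sum_mem fun _ _ => hV _ _ _ _)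
    · rw [Matrix.smul_apply, Matrix.one_apply]
      refine V.smul_mem _ ?_
      split_ifs
      · exact Submodule.subset_span (Or.inl rfl)
      · exact V.zero_mem
  have h2 := (Submodule.add_mem_iff_left V (V.smul_mem _ (V.sum_mem fun e he =>
    ih e (by simpa using he) b e d))).mp hrhs
  split_ifs at h2
  · have := V.smul_mem qi h2
    rwa [smul_smul, mul_comm, h, one_smul] at this
  · simpa using h2

end Exchange

/-! ### Spanning by ordered products of words. -/

section Spanning

variable {S B : Type*} [CommRing S] [Ring B] [Algebra S B]

/-- If the products `y m * z l` can be reordered, the algebra generated by the `z l` and `y m` is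
spanned by the products of a word in the `z l` and a word in the `y m`. -/
theorem adjoin_le_span_words {Λ Λ' : Type*} (z : Λ → B) (y : Λ' → B)
    (h : ∀ l m, y m * z l ∈ Submodule.span S (insert 1 {p | ∃ l' m', p = z l' * y m'})) :
    Subalgebra.toSubmodule (Algebra.adjoin S (Set.range y ∪ Set.range z)) ≤
      Submodule.span S {p | ∃ (u : List Λ) (v : List Λ'), p = (u.map z).prod * (v.map y).prod} := by
  set T := Submodule.span S
    {p | ∃ (u : List Λ) (v : List Λ'), p = (u.map z).prod * (v.map y).prod}
  have hle : ∀ (b : B), (∀ (u : List Λ) (v : List Λ'), b * ((u.map z).prod * (v.map y).prod) ∈ T) →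
      ∀ t ∈ T, b * t ∈ T := by
    intro b hb t ht
    have h1 := Submodule.mem_map_of_mem (f := LinearMap.mulLeft S b) ht
    rw [Submodule.map_span] at h1
    refine Submodule.span_le.mpr ?_ h1
    rintro _ ⟨_, ⟨u, v, rfl⟩, rfl⟩
    exact hb u v
  have hz : ∀ l, ∀ t ∈ T, z l * t ∈ T := fun l => hle _ fun u v =>
    Submodule.subset_span ⟨l :: u, v, by simp [mul_assoc]⟩
  have hy : ∀ m, ∀ t ∈ T, y m * t ∈ T := by
    intro m
    refine hle _ fun u v => ?_
    induction u generalizing m with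
    | nil => exact Submodule.subset_span ⟨[], m :: v, by simp⟩
    | cons l u ih =>
      rw [List.map_cons, List.prod_cons, mul_assoc, ← mul_assoc]
      have h1 := Submodule.mem_map_of_mem
        (f := LinearMap.mulRight S ((u.map z).prod * (v.map y).prod)) (h l m)
      rw [Submodule.map_span] at h1
      refine Submodule.span_le.mpr ?_ h1
      rintro _ ⟨_, rfl | ⟨l', m', rfl⟩, rfl⟩
      · rw [LinearMap.mulRight_apply, one_mul]
        exact Submodule.subset_span ⟨u, v, rfl⟩
      · rw [LinearMap.mulRight_apply, mul_assoc]
        exact hz _ _ (ih m')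
  intro b hb
  have hmul : ∀ t ∈ T, b * t ∈ T := by
    rw [Subalgebra.mem_toSubmodule] at hb
    induction hb using Algebra.adjoin_induction with
    | mem b hb =>
      rcases hb with ⟨m, rfl⟩ | ⟨l, rfl⟩
      · exact hy m
      · exact hz l
    | algebraMap s =>
      intro t ht
      rw [← Algebra.smul_def]
      exact T.smul_mem s ht
    | add b c _ _ h1 h2 =>
      intro t ht
      rw [add_mul]
      exact T.add_mem (h1 t ht) (h2 t ht)
    | mul b c _ _ h1 h2 =>
      intro t ht
      rw [mul_assoc]
      exact h1 _ (h2 t ht)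
  simpa using hmul 1 (Submodule.subset_span ⟨[], [], by simp⟩)

end Spanning

/-! ### The standard monomials span the integral form. -/

section StandardMonomials

variable {n : ℕ}

theorem scalars_brd_integral (r : Fin n → Fin n → Prop) [DecidableRel r] (a b : A) :
    scalars (D1 n) (Fin n × Fin n) (brd r (algebraMap A K a) (algebraMap A K b))
      = scalars (D1 n) (Fin n × Fin n) (brd r a b) := by
  ext u v
  simp only [RingHom.mapMatrix_apply, Matrix.map_apply, brd, Matrix.of_apply]
  rw [IsScalarTower.algebraMap_apply A K (D1 n)]
  congr 1
  simp only [map_add, apply_ite (algebraMap A K), map_sub, map_one, map_zero]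

theorem qA_mul_T : qA * LaurentPolynomial.T (-1) = 1 := by
  rw [qA, ← LaurentPolynomial.T_add, add_neg_cancel, LaurentPolynomial.T_zero]

theorem xWord_mem_span (w : List (Fin n ×ₗ Fin n)) :
    (w.map fun p => (x (ofLex p).1 (ofLex p).2 : D1 n)).prod ∈ Submodule.span A
      {p | ∃ w' : List (Fin n ×ₗ Fin n), w'.Pairwise (fun a b => a ≤ b) ∧
        p = (w'.map fun p => (x (ofLex p).1 (ofLex p).2 : D1 n)).prod} := by
  refine Submodule.span_mono ?_ (word_mem_span_sorted
    (fun p : Fin n ×ₗ Fin n => (x (ofLex p).1 (ofLex p).2 : D1 n)) (fun l m hml => ?_) w)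
  · rintro p ⟨w', h1, -, h2⟩
    exact ⟨w', h1, h2⟩
  · have h := (braidedRel_toD1 (n := n)).xx
    rw [q_inv_eq, q, scalars_brd_integral] at h
    refine Submodule.span_mono ?_ (reflection_straighten (· < ·) qA_mul_T h _ _ _ _ hml)
    rintro p ⟨l', m', h1, h2⟩
    exact ⟨toLex l', toLex m', h1, h2⟩

theorem dWord_mem_span (w : List (Fin n ×ₗ Fin n)) :
    (w.map fun p => (d (ofLex p).1 (ofLex p).2 : D1 n)).prod ∈ Submodule.span A
      {p | ∃ w' : List (Fin n ×ₗ Fin n), w'.Pairwise (fun a b => b ≤ a) ∧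
        p = (w'.map fun p => (d (ofLex p).1 (ofLex p).2 : D1 n)).prod} := by
  -- The relation for the `∂` uses the inverse braiding, which is the braiding of the reversed order
  -- with `q` and `q⁻¹` exchanged. Hence their standard words are decreasing.
  refine Submodule.span_mono ?_ (word_mem_span_sorted (Λ := (Fin n ×ₗ Fin n)ᵒᵈ)
    (fun p => (d (ofLex (OrderDual.ofDual p)).1 (ofLex (OrderDual.ofDual p)).2 : D1 n))
    (fun l m hml => ?_) w)
  · rintro p ⟨w', h1, -, h2⟩
    exact ⟨w', h1, h2⟩
  · have h := (braidedRel_toD1 (n := n)).dd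
    rw [q_inv_eq, q, scalars_brd_integral] at h
    have hlex : ∀ u v : Fin n × Fin n, Prod.Lex (· > ·) (· > ·) u v ↔ toLex v < toLex u := by
      intro u v
      rw [Prod.lex_def, Prod.Lex.toLex_lt_toLex]
      simp only [gt_iff_lt, eq_comm]
    refine Submodule.span_mono ?_ (reflection_straighten (· > ·)
      ((mul_comm _ _).trans qA_mul_T) h _ _ _ _ ((hlex (ofLex (OrderDual.ofDual m))
        (ofLex (OrderDual.ofDual l))).mpr hml))
    rintro p ⟨l', m', h1, h2⟩
    exact ⟨OrderDual.toDual (toLex l'), OrderDual.toDual (toLex m'), (hlex _ _).mp h1, h2⟩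

theorem x_mul_d_mem_span (l m : Fin n ×ₗ Fin n) :
    (x (ofLex m).1 (ofLex m).2 * d (ofLex l).1 (ofLex l).2 : D1 n) ∈ Submodule.span A
      (insert 1 {p | ∃ l' m' : Fin n ×ₗ Fin n,
        p = d (ofLex l').1 (ofLex l').2 * x (ofLex m').1 (ofLex m').2}) := by
  have h := (braidedRel_toD1 (n := n)).dx
  rw [q_inv_eq, q, scalars_brd_integral, scalars_brd_integral, ← map_sub, ← map_neg,
    algebraMap_smul] at h
  exact mul_mem_of_exchange qA_mul_T _ h _ _ _ _

theorem span_stdMonomial :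
    Submodule.span A (Set.range (stdMonomial (n := n))) = Subalgebra.toSubmodule (D1Z n) := by
  have hgen : {y : D1 n | ∃ i j : Fin n, y = x i j} ∪ {y | ∃ i j : Fin n, y = d i j}
      = Set.range (fun p : Fin n ×ₗ Fin n => (x (ofLex p).1 (ofLex p).2 : D1 n))
        ∪ Set.range (fun p : Fin n ×ₗ Fin n => (d (ofLex p).1 (ofLex p).2 : D1 n)) := by
    congr 1 <;> ext y <;> constructor
    · rintro ⟨i, j, rfl⟩; exact ⟨toLex (i, j), rfl⟩
    · rintro ⟨p, rfl⟩; exact ⟨_, _, rfl⟩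
    · rintro ⟨i, j, rfl⟩; exact ⟨toLex (i, j), rfl⟩
    · rintro ⟨p, rfl⟩; exact ⟨_, _, rfl⟩
  apply le_antisymm
  · rw [Submodule.span_le]
    rintro _ ⟨s, rfl⟩
    refine (D1Z n).mul_mem (Subalgebra.list_prod_mem _ ?_) (Subalgebra.list_prod_mem _ ?_)
    · intro y hy
      obtain ⟨p, -, rfl⟩ := List.mem_map.mp hy
      exact (dZ _ _).2
    · intro y hy
      obtain ⟨p, -, rfl⟩ := List.mem_map.mp hy
      exact (xZ _ _).2
  · rw [D1Z, hgen]
    refine (adjoin_le_span_words _ _ x_mul_d_mem_span).trans (Submodule.span_le.mpr ?_)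
    rintro _ ⟨u, v, rfl⟩
    have h := Submodule.mul_mem_mul (dWord_mem_span u) (xWord_mem_span v)
    rw [Submodule.span_mul_span] at h
    refine Submodule.span_mono ?_ h
    rintro _ ⟨_, ⟨u', hu', rfl⟩, _, ⟨v', hv', rfl⟩, rfl⟩
    exact ⟨⟨u', v', hu', hv'⟩, rfl⟩

end StandardMonomials

/-! ### Basis and flatness of the integral form. -/

section IntegralBasis

variable {n : ℕ}

/-- The standard monomials, as elements of the integral form. -/
def stdZ (s : StdIndex n) : D1Z n :=
  (s.ds.map fun p => dZ (ofLex p).1 (ofLex p).2).prod *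
    (s.xs.map fun p => xZ (ofLex p).1 (ofLex p).2).prod

theorem coe_stdZ (s : StdIndex n) : (stdZ s : D1 n) = stdMonomial s := by
  have h := map_mul (D1Z n).val (s.ds.map fun p => dZ (ofLex p).1 (ofLex p).2).prod
    (s.xs.map fun p => xZ (ofLex p).1 (ofLex p).2).prod
  rw [map_list_prod, map_list_prod, List.map_map, List.map_map] at h
  exact h

/-- The basis of standard monomials of the integral form. -/
def stdBasis (n : ℕ) : Module.Basis (StdIndex n) A (D1Z n) :=
  (Module.Basis.span linearIndependent_stdMonomial).map
    (LinearEquiv.ofEq _ _ span_stdMonomial : _ ≃ₗ[A] Subalgebra.toSubmodule (D1Z n))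

theorem coe_stdBasis (s : StdIndex n) : (stdBasis n s : D1 n) = stdMonomial s := by
  have h := Module.Basis.span_apply (linearIndependent_stdMonomial (n := n)) s
  rw [stdBasis, Module.Basis.map_apply, LinearEquiv.coe_ofEq_apply]
  exact congrArg Subtype.val h

theorem stdBasis_eq (s : StdIndex n) : stdBasis n s = stdZ s :=
  Subtype.ext (by rw [coe_stdBasis, coe_stdZ])

instance : Module.Flat A (D1Z n) :=
  have := Module.Free.of_basis (stdBasis n)
  Module.Flat.of_free

end IntegralBasis

/-! ### The generic fibre. -/

section GenericFibre

variable {n : ℕ}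

theorem exists_smul_mem_D1Z (y : D1 n) : ∃ a ∈ nonZeroDivisors A, a • y ∈ D1Z n := by
  obtain ⟨w, rfl⟩ : ∃ w, toD1 n w = y := RingQuot.mkAlgHom_surjective K (Rel n) y
  induction w using FreeAlgebra.induction with
  | grade0 r =>
    obtain ⟨⟨b, a⟩, h⟩ := IsLocalization.surj (nonZeroDivisors A) r
    refine ⟨a, a.2, ?_⟩
    have h1 : (a : A) • toD1 n (algebraMap K (Free n) r) = algebraMap A (D1 n) b := by
      rw [AlgHom.commutes, Algebra.smul_def, IsScalarTower.algebraMap_apply A K (D1 n),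
        IsScalarTower.algebraMap_apply A K (D1 n), ← map_mul, mul_comm]
      exact congrArg _ h
    rw [h1]
    exact (D1Z n).algebraMap_mem b
  | grade1 g =>
    refine ⟨1, one_mem _, ?_⟩
    rw [one_smul]
    cases g with
    | x i j => exact (xZ i j).2
    | d i j => exact (dZ i j).2
  | mul u v hu hv =>
    obtain ⟨a, ha, ha'⟩ := hu
    obtain ⟨b, hb, hb'⟩ := hv
    refine ⟨a * b, mul_mem ha hb, ?_⟩
    rw [map_mul, ← smul_mul_smul_comm]
    exact (D1Z n).mul_mem ha' hb'
  | add u v hu hv =>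
    obtain ⟨a, ha, ha'⟩ := hu
    obtain ⟨b, hb, hb'⟩ := hv
    refine ⟨a * b, mul_mem ha hb, ?_⟩
    rw [map_add, smul_add]
    refine (D1Z n).add_mem ?_ ?_
    · rw [mul_comm, mul_smul]
      exact (D1Z n).smul_mem ha' b
    · rw [mul_smul]
      exact (D1Z n).smul_mem hb' a

/-- Base change to the fraction field is localization, so it suffices that nonzero Laurent
polynomials act invertibly on `𝓓₁` and that denominators can be cleared; the inclusion is injective.
-/
theorem isBaseChange_D1Z : IsBaseChange K (D1Z n).val.toLinearMap := by
  rw [← isLocalizedModule_iff_isBaseChange (nonZeroDivisors A) K]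
  refine ⟨fun a => ?_, fun y => ?_, fun {y z} h => ⟨1, by rw [Subtype.ext h]⟩⟩
  · have ha : algebraMap A K a ≠ 0 := IsFractionRing.to_map_ne_zero_of_mem_nonZeroDivisors a.2
    rw [Module.End.isUnit_iff]
    refine Function.bijective_iff_has_inverse.mpr ⟨fun y => (algebraMap A K a)⁻¹ • y, ?_, ?_⟩
    · intro y
      rw [Module.algebraMap_end_apply, ← algebraMap_smul K]
      dsimp only
      rw [smul_smul, inv_mul_cancel₀ ha, one_smul]
    · intro y
      rw [Module.algebraMap_end_apply, ← algebraMap_smul K, smul_smul, mul_inv_cancel₀ ha,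
        one_smul]
  · obtain ⟨a, ha, h⟩ := exists_smul_mem_D1Z y
    exact ⟨(⟨_, h⟩, ⟨a, ha⟩), rfl⟩

end GenericFibre

/-! ### The fibre at `q = 1`. -/

section SpecialFibre

variable {n : ℕ}

theorem algebraMap_eq_evOne (a : A) :
    algebraMap A (D1AtOne n) a = algebraMap ℂ (D1AtOne n) (evOne a) := by
  obtain ⟨b, hb⟩ := sub_one_dvd_sub_C_evOne a
  have h0 : algebraMap A (D1AtOne n) (qA - 1) = 0 :=
    Ideal.Quotient.eq_zero_iff_mem.mpr (Ideal.subset_span rfl)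
  rw [IsScalarTower.algebraMap_apply ℂ A (D1AtOne n), ← sub_eq_zero, ← map_sub]
  have h1 : algebraMap A (D1AtOne n) (a - LaurentPolynomial.C (evOne a)) = 0 := by
    rw [hb, map_mul, h0, zero_mul]
  exact h1

theorem mapMatrix_inLast {S B B' ι : Type*} [CommRing S] [Ring B] [Algebra S B] [Ring B']
    [Algebra S B'] [Fintype ι] [DecidableEq ι] (f : B →ₐ[S] B') (Z : Matrix ι ι B) :
    f.mapMatrix (inLast ι Z) = inLast ι (f.mapMatrix Z) := by
  ext ⟨a, b⟩ ⟨c, e⟩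
  simp [inLast_apply, apply_ite f]

theorem mapMatrix_scalars {S B B' m : Type*} [CommRing S] [Ring B] [Algebra S B] [Ring B']
    [Algebra S B'] [Fintype m] [DecidableEq m] (f : B →ₐ[S] B') (M : Matrix m m S) :
    f.mapMatrix (scalars B m M) = scalars B' m M := by
  ext a b
  simp

theorem scalars_brd_atOne (r : Fin n → Fin n → Prop) [DecidableRel r] (m m' : ℤ) :
    scalars (D1AtOne n) (Fin n × Fin n)
      (brd r (LaurentPolynomial.T m : A) (LaurentPolynomial.T m'))
      = scalars (D1AtOne n) (Fin n × Fin n) (brd r (1 : A) 1) := by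
  have h : ∀ m : ℤ, algebraMap A (D1AtOne n) (LaurentPolynomial.T m) = 1 := fun m => by
    rw [algebraMap_eq_evOne, evOne_T, map_one]
  ext u v
  simp only [RingHom.mapMatrix_apply, Matrix.map_apply, brd, Matrix.of_apply, map_add,
    apply_ite (algebraMap A (D1AtOne n)), map_sub, h, map_one, map_zero]

/-- The reflection equation at `q = 1` is commutativity. -/
theorem commute_of_reflection {S B ι : Type*} [CommRing S] [Ring B] [Algebra S B] [Fintype ι]
    [DecidableEq ι] (r : ι → ι → Prop) [DecidableRel r] {Z : Matrix ι ι B}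
    (hZ : scalars B _ (brd r (1 : S) 1) * inLast ι Z * scalars B _ (brd r (1 : S) 1) * inLast ι Z
      = inLast ι Z * scalars B _ (brd r (1 : S) 1) * inLast ι Z * scalars B _ (brd r (1 : S) 1))
    (a b c d : ι) : Commute (Z a c) (Z b d) := by
  have h := congrArg (fun M : Matrix (ι × ι) (ι × ι) B => M (a, b) (c, d)) hZ
  simp only [mul_assoc (scalars B _ (brd r (1 : S) 1)), brd_mul_apply, mul_brd_apply,
    sandwich_apply] at h
  simpa [commute_iff_eq] using h

theorem commute_of_exchange {S B ι : Type*} [CommRing S] [Ring B] [Algebra S B] [Fintype ι]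
    [LinearOrder ι] {C N : Matrix ι ι B}
    (hCN : inLast ι N * scalars B _ (brd (· < ·) (1 : S) 1) * inLast ι C
      = scalars B _ (brd (· > ·) (1 : S) 1) * (inLast ι C * scalars B _ (brd (· > ·) (1 : S) 1) *
        inLast ι N) * scalars B _ (brd (· < ·) (1 : S) 1)) (a b c d : ι) :
    Commute (N b c) (C a d) := by
  have h := congrArg (fun M : Matrix (ι × ι) (ι × ι) B => M (a, b) (c, d)) hCN
  simp only [exchange_apply, sandwich_apply] at h
  simpa [commute_iff_eq] using h

/-- The class at `q = 1` of a generator. -/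
def genAtOne (g : Gen n) : D1AtOne n :=
  match g with
  | Gen.x i j => Ideal.Quotient.mk (qOneIdeal n) (xZ i j)
  | Gen.d i j => Ideal.Quotient.mk (qOneIdeal n) (dZ i j)

/-- The braided relations have coefficients in `ℂ[q, q⁻¹]`, so they pull back along the injection
into `𝓓₁` and may be reduced modulo `q - 1`. There the braiding becomes the flip and the
inhomogeneous term vanishes. -/
theorem genAtOne_commute (g g' : Gen n) : Commute (genAtOne g) (genAtOne g') := by
  let v : D1Z n →ₐ[A] D1 n := (D1Z n).val
  let π : D1Z n →ₐ[A] D1AtOne n := Ideal.Quotient.mkₐ A (qOneIdeal n)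
  have hv : Function.Injective (v.mapMatrix (m := Fin n × Fin n)) := by
    intro M M' h
    ext1 a b
    exact Subtype.ext (congrFun (congrFun h a) b)
  let Xz : Matrix (Fin n) (Fin n) (D1Z n) := Matrix.of xZ
  let Dz : Matrix (Fin n) (Fin n) (D1Z n) := Matrix.of dZ
  have hX : genX (toD1 n) = v.mapMatrix Xz := rfl
  have hD : genD (toD1 n) = v.mapMatrix Dz := rfl
  have hxx := (braidedRel_toD1 (n := n)).xx
  have hdd := (braidedRel_toD1 (n := n)).dd
  have hdx := (braidedRel_toD1 (n := n)).dx
  rw [q_inv_eq, q, scalars_brd_integral, hX, ← mapMatrix_inLast, ← mapMatrix_scalars v] at hxx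
  rw [q_inv_eq, q, scalars_brd_integral, hD, ← mapMatrix_inLast, ← mapMatrix_scalars v] at hdd
  rw [q_inv_eq, q, scalars_brd_integral, scalars_brd_integral, ← map_sub, ← map_neg,
    algebraMap_smul, hX, hD, ← mapMatrix_inLast, ← mapMatrix_inLast, ← mapMatrix_scalars v,
    ← mapMatrix_scalars v, ← map_one v.mapMatrix, ← map_smul] at hdx
  simp only [← map_mul, ← map_add] at hxx hdd hdx
  replace hxx := congrArg π.mapMatrix (hv hxx)
  replace hdd := congrArg π.mapMatrix (hv hdd)
  replace hdx := congrArg π.mapMatrix (hv hdx)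
  have h0 : (-(qA - LaurentPolynomial.T (-1))) •
      (1 : Matrix (Fin n × Fin n) (Fin n × Fin n) (D1AtOne n)) = 0 := by
    rw [Algebra.smul_def]
    ext a b
    simp [Matrix.algebraMap_matrix_apply, Matrix.mul_apply, algebraMap_eq_evOne, qA, evOne_T]
  simp only [map_mul, map_add, map_smul, map_one, mapMatrix_inLast, mapMatrix_scalars, qA,
    scalars_brd_atOne] at hxx hdd hdx
  rw [← qA, h0, add_zero] at hdx
  have cxx := commute_of_reflection _ hxx
  have cdd := commute_of_reflection _ hdd
  have cdx := commute_of_exchange hdx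
  cases g with
  | x i j =>
    cases g' with
    | x k l => exact cxx i k j l
    | d k l => exact cdx k i j l
  | d i j =>
    cases g' with
    | x k l => exact (cdx i k l j).symm
    | d k l => exact cdd i k j l

theorem D1AtOne_induction {p : D1AtOne n → Prop} (hgen : ∀ g, p (genAtOne g))
    (hC : ∀ c : ℂ, p (algebraMap ℂ _ c)) (hadd : ∀ a b, p a → p b → p (a + b))
    (hmul : ∀ a b, p a → p b → p (a * b)) (y : D1AtOne n) : p y := by
  obtain ⟨⟨y, hy⟩, rfl⟩ := Ideal.Quotient.mk_surjective y
  induction hy using Algebra.adjoin_induction with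
  | mem y hy =>
    rcases hy with ⟨i, j, rfl⟩ | ⟨i, j, rfl⟩
    · exact hgen (Gen.x i j)
    · exact hgen (Gen.d i j)
  | algebraMap a =>
    have h := hC (evOne a)
    rwa [← algebraMap_eq_evOne] at h
  | add a b _ _ h1 h2 => exact hadd _ _ h1 h2
  | mul a b _ _ h1 h2 => exact hmul _ _ h1 h2

theorem D1AtOne_mul_comm (y z : D1AtOne n) : y * z = z * y := by
  have h1 : ∀ g (z : D1AtOne n), Commute (genAtOne g) z := fun g =>
    D1AtOne_induction (genAtOne_commute g) (fun c => (Algebra.commute_algebraMap_right c _))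
      (fun _ _ => Commute.add_right) (fun _ _ => Commute.mul_right)
  exact D1AtOne_induction (p := fun y => Commute y z) (fun g => h1 g z)
    (fun c => Algebra.commute_algebraMap_left c z) (fun _ _ => Commute.add_left)
    (fun _ _ => Commute.mul_left) y

theorem exists_algHom_of_mul_comm {σ B : Type*} [Ring B] [Algebra ℂ B]
    (h : ∀ y z : B, y * z = z * y) (f : σ → B) :
    ∃ φ : MvPolynomial σ ℂ →ₐ[ℂ] B, ∀ i, φ (MvPolynomial.X i) = f i := by
  let _ : CommRing B := { ‹Ring B› with mul_comm := h }
  exact ⟨MvPolynomial.aeval f, MvPolynomial.aeval_X f⟩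

/-- The standard monomials in the coordinate ring. -/
def stdPoly (s : StdIndex n) : CoordRing n :=
  (s.ds.map fun p => MvPolynomial.X (Gen.d (ofLex p).1 (ofLex p).2)).prod *
    (s.xs.map fun p => MvPolynomial.X (Gen.x (ofLex p).1 (ofLex p).2)).prod

theorem span_stdPoly : Submodule.span ℂ (Set.range (stdPoly (n := n))) = ⊤ := by
  rw [eq_top_iff]
  intro p _
  induction p using MvPolynomial.induction_on with
  | C a =>
    rw [← mul_one (MvPolynomial.C a), ← MvPolynomial.smul_eq_C_mul]
    exact Submodule.smul_mem _ _ (Submodule.subset_span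
      ⟨⟨[], [], List.Pairwise.nil, List.Pairwise.nil⟩, by simp [stdPoly]⟩)
  | add p p' h h' => exact Submodule.add_mem _ (h trivial) (h' trivial)
  | mul_X p g h =>
    have h1 := Submodule.mem_map_of_mem (f := LinearMap.mulRight ℂ (MvPolynomial.X g)) (h trivial)
    rw [Submodule.map_span] at h1
    refine Submodule.span_mono ?_ h1
    rintro _ ⟨_, ⟨s, rfl⟩, rfl⟩
    rw [LinearMap.mulRight_apply]
    cases g with
    | x i j =>
      refine ⟨⟨s.ds, (toLex (i, j) :: s.xs).insertionSort (· ≤ ·), s.ds_decreasing,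
        List.pairwise_insertionSort _ _⟩, ?_⟩
      have h2 := ((List.perm_insertionSort (· ≤ ·) (toLex (i, j) :: s.xs)).map fun p =>
        (MvPolynomial.X (Gen.x (ofLex p).1 (ofLex p).2) : CoordRing n)).prod_eq
      simp only [stdPoly, h2, List.map_cons, List.prod_cons, ofLex_toLex]
      ring
    | d i j =>
      refine ⟨⟨(toLex (i, j) :: s.ds).insertionSort (fun a b => b ≤ a), s.xs,
        List.pairwise_insertionSort _ _, s.xs_increasing⟩, ?_⟩
      have h2 := ((List.perm_insertionSort (fun a b => b ≤ a) (toLex (i, j) :: s.ds)).map fun p =>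
        (MvPolynomial.X (Gen.d (ofLex p).1 (ofLex p).2) : CoordRing n)).prod_eq
      simp only [stdPoly, h2, List.map_cons, List.prod_cons, ofLex_toLex]
      ring

/-- The `q = 1` specialization of the coordinates with respect to the standard monomials. -/
def symbolAtOne (y : D1Z n) : CoordRing n :=
  ((stdBasis n).repr y).sum fun s a => evOne a • stdPoly s

theorem symbolAtOne_add (y z : D1Z n) : symbolAtOne (y + z) = symbolAtOne y + symbolAtOne z := by
  rw [symbolAtOne, map_add, Finsupp.sum_add_index' (by simp) (by simp [add_smul])]
  rfl

theorem symbolAtOne_smul (a : A) (y : D1Z n) :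
    symbolAtOne (a • y) = evOne a • symbolAtOne y := by
  rw [symbolAtOne, map_smul, Finsupp.sum_smul_index (by simp), symbolAtOne, Finsupp.smul_sum]
  simp only [map_mul, mul_smul]

theorem symbolAtOne_stdZ (s : StdIndex n) : symbolAtOne (stdZ s) = stdPoly s := by
  rw [symbolAtOne, ← stdBasis_eq, Module.Basis.repr_self, Finsupp.sum_single_index (by simp),
    map_one, one_smul]

theorem symbolAtOne_of_mem {y : D1Z n} (hy : y ∈ qOneIdeal n) : symbolAtOne y = 0 := by
  obtain ⟨z, rfl⟩ := Ideal.mem_span_singleton'.mp hy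
  rw [← Algebra.commutes, ← Algebra.smul_def, symbolAtOne_smul, evOne_sub_one, zero_smul]

theorem exists_equiv_atOne : ∃ e : D1AtOne n ≃ₐ[ℂ] CoordRing n,
    ∀ g, e (genAtOne g) = MvPolynomial.X g := by
  obtain ⟨φ, hφ⟩ := exists_algHom_of_mul_comm (D1AtOne_mul_comm (n := n)) genAtOne
  have hstd : ∀ s : StdIndex n, φ (stdPoly s) = Ideal.Quotient.mk (qOneIdeal n) (stdZ s) := by
    intro s
    rw [stdPoly, stdZ, map_mul, map_mul, map_list_prod, map_list_prod, map_list_prod,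
      map_list_prod, List.map_map, List.map_map, List.map_map, List.map_map]
    simp only [Function.comp_def, hφ]
    rfl
  -- A lift of `φ p` to the integral form whose coordinates at `q = 1` recover `p`. If `φ p = 0`,
  -- the lift lies in the ideal, where these coordinates vanish, so `p = 0`. Only spanning by the
  -- `stdPoly s` is needed, not their independence.
  have hlift : ∀ p : CoordRing n, ∃ y : D1Z n,
      Ideal.Quotient.mk (qOneIdeal n) y = φ p ∧ symbolAtOne y = p := by
    intro p
    have hp : p ∈ Submodule.span ℂ (Set.range (stdPoly (n := n))) := span_stdPoly ▸ trivial
    induction hp using Submodule.span_induction with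
    | mem p hp =>
      obtain ⟨s, rfl⟩ := hp
      exact ⟨stdZ s, (hstd s).symm, symbolAtOne_stdZ s⟩
    | zero => exact ⟨0, by simp, symbolAtOne_of_mem (Ideal.zero_mem _)⟩
    | add p p' _ _ h h' =>
      obtain ⟨y, h1, h2⟩ := h
      obtain ⟨y', h1', h2'⟩ := h'
      exact ⟨y + y', by rw [map_add, map_add, h1, h1'], by rw [symbolAtOne_add, h2, h2']⟩
    | smul c p _ h =>
      obtain ⟨y, h1, h2⟩ := h
      refine ⟨LaurentPolynomial.C c • y, ?_, by rw [symbolAtOne_smul, h2, evOne_C]⟩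
      rw [Algebra.smul_def, map_mul, map_smul φ, ← h1, Algebra.smul_def]
      rfl
  have hinj : Function.Injective φ := by
    rw [injective_iff_map_eq_zero]
    intro p hp
    obtain ⟨y, h1, rfl⟩ := hlift p
    exact symbolAtOne_of_mem (Ideal.Quotient.eq_zero_iff_mem.mp (h1.trans hp))
  have hsurj : Function.Surjective φ := fun y =>
    D1AtOne_induction (p := fun y => ∃ p, φ p = y) (fun g => ⟨_, hφ g⟩)
      (fun c => ⟨algebraMap ℂ _ c, φ.commutes c⟩)
      (fun _ _ ⟨p, hp⟩ ⟨p', hp'⟩ => ⟨p + p', by rw [map_add, hp, hp']⟩)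
      (fun _ _ ⟨p, hp⟩ ⟨p', hp'⟩ => ⟨p * p', by rw [map_mul, hp, hp']⟩) y
  refine ⟨(AlgEquiv.ofBijective φ ⟨hinj, hsurj⟩).symm, fun g => ?_⟩
  rw [AlgEquiv.symm_apply_eq]
  exact (hφ g).symm

end SpecialFibre

end QDiff

end

theorem mainTheorem6 (n : ℕ) :
    -- the standard monomials are a basis of the integral form over the Laurent polynomials
    (∃ b : Module.Basis (QDiff.StdIndex n) QDiff.A (QDiff.D1Z n),
      ∀ s : QDiff.StdIndex n, ((b s : QDiff.D1Z n) : QDiff.D1 n) = QDiff.stdMonomial s) ∧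
    -- the integral form is flat, its generic fibre is the whole algebra,
    Module.Flat QDiff.A (QDiff.D1Z n) ∧
    IsBaseChange QDiff.K (QDiff.D1Z n).val.toLinearMap ∧
    -- and its fibre at q = 1 is the coordinate ring of the cotangent bundle of the matrix space
    ∃ e : QDiff.D1AtOne n ≃ₐ[ℂ] QDiff.CoordRing n,
      ∀ i j : Fin n,
        e (Ideal.Quotient.mk (QDiff.qOneIdeal n) (QDiff.xZ i j))
          = MvPolynomial.X (QDiff.Gen.x i j) ∧
        e (Ideal.Quotient.mk (QDiff.qOneIdeal n) (QDiff.dZ i j))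
          = MvPolynomial.X (QDiff.Gen.d i j) := by
  obtain ⟨e, he⟩ := QDiff.exists_equiv_atOne (n := n)
  exact ⟨⟨QDiff.stdBasis n, QDiff.coe_stdBasis⟩, inferInstance, QDiff.isBaseChange_D1Z, e,
    fun i j => ⟨he (QDiff.Gen.x i j), he (QDiff.Gen.d i j)⟩⟩
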